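/- Let $T$ be a $\sigma$-compact metric space and $\nu$ a Borel probability measure on $T$ with $\nu(B)>0$ for every nonempty open $B\subset T$. Let $K^1,K^2:T\times T\to\mathbb{R}$ be continuous, symmetric, positive definite kernels (that is, $\sum_{j,k}a_ja_kK^i(t_j,t_k)\ge 0$ for all finitely many points $t_j \in T$ and reals $a_j$), and let $\kappa_1,\kappa_2>0$ be such that $\sup_{t\in T}K^i(t,t)\le\kappa_i^2$, $i=1,2$. For $i=1,2$ let $\xi^i=(\xi^i(\omega,t))_{t\in T}$ be a centered Gaussian process with covariance function $K^i$ on a probability space $(\Omega_i,\mathcal F_i,P_i)$. For probability measures $\mu,\mu'$ on $\mathbb{R}^m$ with finite second moments and $\epsilon>0$, let $$\mathrm{OT}^\epsilon(\mu,\mu')=\inf_{\gamma\in\mathrm{Joint}(\mu,\mu')}\Big\{\int\|x-y\|^2\,d\gamma(x,y)+\epsilon\,\mathrm{KL}(\gamma\,\|\,\mu\otimes\mu')\Big\},$$ $$\mathrm{S}^\epsilon_2(\mu,\mu')=\mathrm{OT}^\epsilon(\mu,\mu')-\tfrac12\big(\mathrm{OT}^\epsilon(\mu,\mu)+\mathrm{OT}^\epsilon(\mu',\mu')\big),$$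 where $\mathrm{Joint}(\mu,\mu')$ is the set of joint probability measures with marginals $\mu$ and $\mu'$, $\mathrm{KL}$ is the Kullback-Leibler divergence and $\|\cdot\|$ is the Euclidean norm. Fix $m,N\ge 1$, points $\mathbf X=(x_1,\dots,x_m)\in T^m$ and $\epsilon>0$. Let $K^i[\mathbf X]=(K^i(x_j,x_k))_{j,k=1}^m$. For $\mathbf W^i=(\omega^i_1,\dots,\omega^i_N)$ sampled independently from $(\Omega_i,P_i)$ let $$\hat K^i_{\mathbf W^i}[\mathbf X]=\Big(\frac1N\sum_{l=1}^N\xi^i(\omega^i_l,x_j)\,\xi^i(\omega^i_l,x_k)\Big)_{j,k=1}^m .$$ Then for every $0<\delta<1$, with probability at least $1-\delta$ with respect to the product space $(\Omega_1,P_1)^N\times(\Omega_2,P_2)^N$, $$\Big|\mathrm{S}^\epsilon_2\big[\mathcal N(0,\tfrac1m\hat K^1_{\mathbf W^1}[\mathbf X]),\mathcal N(0,\tfrac1m\hat K^2_{\mathbf W^2}[\mathbf X])\big]-\mathrm{S}^\epsilon_2\big[\mathcal N(0,\tfrac1m K^1[\mathbf X]),\mathcal N(0,\tfrac1m K^2[\mathbf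 X])\big]\Big|$$ $$\le\frac{12\sqrt3}{\epsilon\delta}\Big[\Big(1+\frac4\delta\Big)\kappa_1^4+\Big(3+\frac8\delta\Big)\kappa_1^2\kappa_2^2+\kappa_2^4\Big]\frac1{\sqrt N}.$$ -/

import Mathlib

open MeasureTheory ProbabilityTheory
open scoped ENNReal

namespace SinkhornGP

/-- `Joint(μ, ν)`: the measures on the product space with marginals `μ` and `ν`. -/
def IsCoupling {E : Type*} [MeasurableSpace E] (γ : Measure (E × E)) (μ ν : Measure E) : Prop :=
  γ.map Prod.fst = μ ∧ γ.map Prod.snd = ν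

/-- Entropic optimal transport cost for the cost function `c` and regularization `ε`:
`inf { 𝔼_γ[c] + ε KL(γ ‖ μ ⊗ ν) : γ ∈ Joint(μ, ν) }`. -/
noncomputable def entropicOT {E : Type*} [MeasurableSpace E] (c : E → E → ℝ≥0∞) (ε : ℝ)
    (μ ν : Measure E) : ℝ≥0∞ :=
  ⨅ (γ : Measure (E × E)) (_ : IsCoupling γ μ ν),
    ∫⁻ z, c z.1 z.2 ∂γ + ENNReal.ofReal ε * InformationTheory.klDiv γ (μ.prod ν)

/-- The `2`-Sinkhorn divergence
`S₂^ε(μ, ν) = OT^ε_{d²}(μ, ν) - (OT^ε_{d²}(μ, μ) + OT^ε_{d²}(ν, ν)) / 2`, a real number whenever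
`μ` and `ν` are probability measures with finite second moments. -/
noncomputable def sinkhornDiv {E : Type*} [MeasurableSpace E] [PseudoEMetricSpace E] (ε : ℝ)
    (μ ν : Measure E) : ℝ :=
  (entropicOT (fun x y => edist x y ^ 2) ε μ ν).toReal
    - (1 / 2) * ((entropicOT (fun x y => edist x y ^ 2) ε μ μ).toReal
      + (entropicOT (fun x y => edist x y ^ 2) ε ν ν).toReal)

/-- All the entropic costs occurring in the Sinkhorn divergence of two Gaussian measures are finite,
so `toReal` above loses nothing on them. -/
theorem entropicOT_gaussian_ne_top {m : ℕ} (ε : ℝ) (a b : EuclideanSpace ℝ (Fin m))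
    (A B : Matrix (Fin m) (Fin m) ℝ) :
    entropicOT (fun x y => edist x y ^ 2) ε (multivariateGaussian a A) (multivariateGaussian b B)
      ≠ ⊤ := by
  set μ := multivariateGaussian a A
  set ν := multivariateGaussian b B
  have h1 : MemLp (fun z : EuclideanSpace ℝ (Fin m) × EuclideanSpace ℝ (Fin m) => z.1) 2
      (μ.prod ν) :=
    (IsGaussian.memLp_two_id (μ := μ)).comp_measurePreserving measurePreserving_fst
  have h2 : MemLp (fun z : EuclideanSpace ℝ (Fin m) × EuclideanSpace ℝ (Fin m) => z.2) 2
      (μ.prod ν) :=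
    (IsGaussian.memLp_two_id (μ := ν)).comp_measurePreserving measurePreserving_snd
  have h := (h1.sub h2).eLpNorm_lt_top
  rw [eLpNorm_lt_top_iff_lintegral_rpow_enorm_lt_top (by norm_num) (by norm_num)] at h
  refine ne_top_of_le_ne_top (b := ∫⁻ z, edist z.1 z.2 ^ 2 ∂(μ.prod ν)) ?_ ?_
  · refine ne_of_lt ?_
    simpa [edist_eq_enorm_sub] using h
  · refine (iInf₂_le (μ.prod ν) ⟨?_, ?_⟩).trans (by simp)
    · exact measurePreserving_fst.map_eq
    · exact measurePreserving_snd.map_eq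

/-- Symmetric positive definite kernel, in the usual (semidefinite) sense: for all finitely many
points and real coefficients, `∑ i, ∑ j, a i * a j * K (t i) (t j) ≥ 0`. -/
def IsPosDefKernel {T : Type*} (K : T → T → ℝ) : Prop :=
  (∀ s t, K s t = K t s) ∧
    ∀ (n : ℕ) (t : Fin n → T) (a : Fin n → ℝ), 0 ≤ ∑ i, ∑ j, a i * a j * K (t i) (t j)

/-- `ξ ∼ GP(0, K)` on `(Ω, P)`: a centered Gaussian process with covariance function `K`. -/
structure IsCenteredGP {T Ω : Type*} [MeasurableSpace Ω] (ξ : T → Ω → ℝ) (K : T → T → ℝ)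
    (P : Measure Ω) : Prop where
  gaussian : IsGaussianProcess ξ P
  mean : ∀ t, ∫ ω, ξ t ω ∂P = 0
  cov : ∀ s t, ∫ ω, (ξ s ω - ∫ ω', ξ s ω' ∂P) * (ξ t ω - ∫ ω', ξ t ω' ∂P) ∂P = K s t

/-- The Gram matrix `K[X]`. -/
def gram {T : Type*} {m : ℕ} (K : T → T → ℝ) (X : Fin m → T) : Matrix (Fin m) (Fin m) ℝ :=
  Matrix.of fun j k => K (X j) (X k)

/-- The `m × N` data matrix `Z` with entries `ξ(ω_i, x_j)`. -/
def dataMatrix {T Ω : Type*} {m N : ℕ} (ξ : T → Ω → ℝ) (X : Fin m → T) (W : Fin N → Ω) :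
    Matrix (Fin m) (Fin N) ℝ :=
  Matrix.of fun j i => ξ (X j) (W i)

/-- The empirical covariance matrix `K̂_W[X] = (1/N) Z Zᵀ`. -/
noncomputable def empCov {T Ω : Type*} {m N : ℕ} (ξ : T → Ω → ℝ) (X : Fin m → T)
    (W : Fin N → Ω) : Matrix (Fin m) (Fin m) ℝ :=
  (1 / (N : ℝ)) • (dataMatrix ξ X W * (dataMatrix ξ X W).transpose)

end SinkhornGP

/-! The theorem combines a deterministic stability estimate for Gaussian Sinkhorn divergences with a
second-moment bound on the empirical covariances.

Stability comes from entropic duality. If `exp ((a ⊕ b - d) / ε)` has total mass one under `μ ⊗ ν`,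
then `∫ a + ∫ b` is a lower bound for the entropic cost, and it equals the cost when both marginal
equations (the Schrödinger system) hold pointwise. The equation in the second variable alone forces
mass one for every first marginal. Hence optimal potentials for `(A, B)` remain feasible for `(A',
B)`, which yields a subgradient inequality, and exchanging `A` and `A'` yields the reverse bound
(`exists_gaussianOT_subgradient`).

For centered Gaussians the potentials are quadratic, built from a matrix system solved explicitly in
`exists_matrix_schrodinger`. Apart from the part `‖x‖²`, which contributes a trace, the quadratic
term is governed by a matrix `R` with `0 ≤ R ≤ (4 / ε²) B`. So the cost minus the trace is Lipschitz
in `A` for the Hilbert–Schmidt norm, with constant `(2 / ε) ‖B‖`. The traces cancel in the Sinkhorn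
divergence (`abs_sinkhornDiv_sub_le`), so only Hilbert–Schmidt errors remain.

Fourth moments of Gaussian variables bound the mean square of each error by `3 κᵢ⁴ / N`. Markov's
inequality is applied once, to a weighted sum of the two squared errors, so no union bound is
needed. -/

namespace SinkhornGP

/-! ### Duality for entropic optimal transport. -/

section Duality

variable {E : Type*} [MeasurableSpace E] {μ ν : Measure E} {γ : Measure (E × E)}
  {d : E → E → ℝ} {a b : E → ℝ} {ε : ℝ}

theorem IsCoupling.isProbabilityMeasure [IsProbabilityMeasure μ] (hγ : IsCoupling γ μ ν) :
    IsProbabilityMeasure γ := by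
  constructor
  have h : γ.map Prod.fst Set.univ = 1 := by rw [hγ.1]; exact measure_univ
  rwa [Measure.map_apply measurable_fst MeasurableSet.univ, Set.preimage_univ] at h

theorem IsCoupling.measurePreserving_fst (hγ : IsCoupling γ μ ν) :
    MeasurePreserving Prod.fst γ μ := ⟨_root_.measurable_fst, hγ.1⟩

theorem IsCoupling.measurePreserving_snd (hγ : IsCoupling γ μ ν) :
    MeasurePreserving Prod.snd γ ν := ⟨_root_.measurable_snd, hγ.2⟩

theorem IsCoupling.integrable_add (hγ : IsCoupling γ μ ν) (ha : Integrable a μ)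
    (hb : Integrable b ν) : Integrable (fun z : E × E => a z.1 + b z.2) γ :=
  (hγ.measurePreserving_fst.integrable_comp_of_integrable ha).add
    (hγ.measurePreserving_snd.integrable_comp_of_integrable hb)

theorem IsCoupling.integral_add (hγ : IsCoupling γ μ ν) (ha : Integrable a μ)
    (hb : Integrable b ν) :
    ∫ z, (a z.1 + b z.2) ∂γ = ∫ x, a x ∂μ + ∫ y, b y ∂ν := by
  have h1 : ∫ z : E × E, a z.1 ∂γ = ∫ x, a x ∂μ := by
    rw [← hγ.1, integral_map measurable_fst.aemeasurable (hγ.1 ▸ ha.aestronglyMeasurable)]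
  have h2 : ∫ z : E × E, b z.2 ∂γ = ∫ y, b y ∂ν := by
    rw [← hγ.2, integral_map measurable_snd.aemeasurable (hγ.2 ▸ hb.aestronglyMeasurable)]
  rw [← h1, ← h2]
  exact MeasureTheory.integral_add (hγ.measurePreserving_fst.integrable_comp_of_integrable ha)
    (hγ.measurePreserving_snd.integrable_comp_of_integrable hb)

/-- The log-density `(a ⊕ b - d) / ε` attached to a pair of potentials. -/
noncomputable def potentialLogDensity (d : E → E → ℝ) (ε : ℝ) (a b : E → ℝ) (z : E × E) : ℝ :=
  (a z.1 + b z.2 - d z.1 z.2) / ε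

/-- Gibbs' variational inequality for a log-density of total mass one. -/
theorem integral_le_integral_llr {α : Type*} [MeasurableSpace α] {γ π : Measure α}
    [IsProbabilityMeasure γ] [IsProbabilityMeasure π] {h : α → ℝ} (hac : γ ≪ π)
    (hllr : Integrable (llr γ π) γ) (hh : Integrable h γ)
    (hexp : Integrable (fun z => Real.exp (h z)) π) (hone : ∫ z, Real.exp (h z) ∂π = 1) :
    ∫ z, h z ∂γ ≤ ∫ z, llr γ π z ∂γ := by
  have := isProbabilityMeasure_tilted hexp
  -- This is nonnegativity of the divergence of `γ` from `π` tilted by `h`; total mass one removes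
  -- the logarithm of the normalizing constant.
  have h0 := InformationTheory.integral_llr_add_sub_measure_univ_nonneg
    (hac.trans (absolutelyContinuous_tilted hexp))
    (integrable_llr_tilted_right hac hh hllr hexp)
  rw [integral_llr_tilted_right hac hh hexp hllr, hone] at h0
  simpa using h0

/-- Weak duality for entropic optimal transport. -/
theorem ofReal_add_integral_le_cost [IsProbabilityMeasure μ] [IsProbabilityMeasure ν]
    (hε : 0 < ε) (hd : Measurable (Function.uncurry d)) (hd0 : ∀ x y, 0 ≤ d x y)
    (ha : Integrable a μ) (hb : Integrable b ν)
    (hexp : Integrable (fun z => Real.exp (potentialLogDensity d ε a b z)) (μ.prod ν))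
    (hone : ∫ z, Real.exp (potentialLogDensity d ε a b z) ∂(μ.prod ν) = 1)
    (hγ : IsCoupling γ μ ν) :
    ENNReal.ofReal (∫ x, a x ∂μ + ∫ y, b y ∂ν) ≤
      ∫⁻ z, ENNReal.ofReal (d z.1 z.2) ∂γ
        + ENNReal.ofReal ε * InformationTheory.klDiv γ (μ.prod ν) := by
  have := hγ.isProbabilityMeasure
  by_cases hkl : InformationTheory.klDiv γ (μ.prod ν) = ⊤
  · simp [hkl, ENNReal.mul_top, hε]
  by_cases hc : ∫⁻ z, ENNReal.ofReal (d z.1 z.2) ∂γ = ⊤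
  · simp [hc]
  obtain ⟨hac, hllr⟩ := InformationTheory.klDiv_ne_top_iff.1 hkl
  have hdint : Integrable (fun z : E × E => d z.1 z.2) γ :=
    (lintegral_ofReal_ne_top_iff_integrable hd.aestronglyMeasurable
      (Filter.Eventually.of_forall fun z => hd0 z.1 z.2)).1 hc
  have hab := hγ.integrable_add ha hb
  have hh : Integrable (potentialLogDensity d ε a b) γ := (hab.sub hdint).div_const ε
  have hle := integral_le_integral_llr hac hllr hh hexp hone
  have hval : ∫ z, potentialLogDensity d ε a b z ∂γ
      = (∫ x, a x ∂μ + ∫ y, b y ∂ν - ∫ z, d z.1 z.2 ∂γ) / ε := by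
    simp only [potentialLogDensity]
    rw [integral_div, integral_sub hab hdint, hγ.integral_add ha hb]
  rw [InformationTheory.klDiv_of_ac_of_integrable hac hllr,
    ← ofReal_integral_eq_lintegral_ofReal hdint
      (Filter.Eventually.of_forall fun z => hd0 z.1 z.2), ← ENNReal.ofReal_mul hε.le]
  refine le_trans (ENNReal.ofReal_le_ofReal ?_) ENNReal.ofReal_add_le
  rw [hval, div_le_iff₀ hε] at hle
  simp only [probReal_univ, add_sub_cancel_right]
  linarith

/-- The measure with density `exp ((a ⊕ b - d) / ε)` is a coupling when the Schrödinger system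
holds. -/
theorem isCoupling_withDensity [IsProbabilityMeasure μ] [IsProbabilityMeasure ν]
    (hd : Measurable (Function.uncurry d)) (ha : Measurable a) (hb : Measurable b)
    (h1 : ∀ x, ∫⁻ y, ENNReal.ofReal (Real.exp (potentialLogDensity d ε a b (x, y))) ∂ν = 1)
    (h2 : ∀ y, ∫⁻ x, ENNReal.ofReal (Real.exp (potentialLogDensity d ε a b (x, y))) ∂μ = 1) :
    IsCoupling ((μ.prod ν).withDensity
      fun z => ENNReal.ofReal (Real.exp (potentialLogDensity d ε a b z))) μ ν := by
  have hm : Measurable (potentialLogDensity d ε a b) :=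
    (((ha.comp measurable_fst).add (hb.comp measurable_snd)).sub hd).div_const ε
  have hf : Measurable fun z => ENNReal.ofReal (Real.exp (potentialLogDensity d ε a b z)) := by
    fun_prop
  constructor
  · ext s hs
    rw [Measure.map_apply measurable_fst hs, withDensity_apply _ (measurable_fst hs),
      ← lintegral_indicator (measurable_fst hs),
      lintegral_prod _ (hf.indicator (measurable_fst hs)).aemeasurable]
    have : ∀ x, ∫⁻ y, (Prod.fst ⁻¹' s).indicator
        (fun z => ENNReal.ofReal (Real.exp (potentialLogDensity d ε a b z))) (x, y) ∂ν
          = s.indicator 1 x := by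
      intro x
      by_cases hx : x ∈ s
      · simp [Set.indicator, hx, h1 x]
      · simp [Set.indicator, hx]
    simp_rw [this]
    exact lintegral_indicator_one hs
  · ext s hs
    rw [Measure.map_apply measurable_snd hs, withDensity_apply _ (measurable_snd hs),
      ← lintegral_indicator (measurable_snd hs),
      lintegral_prod_symm _ (hf.indicator (measurable_snd hs)).aemeasurable]
    have : ∀ y, ∫⁻ x, (Prod.snd ⁻¹' s).indicator
        (fun z => ENNReal.ofReal (Real.exp (potentialLogDensity d ε a b z))) (x, y) ∂μ
          = s.indicator 1 y := by
      intro y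
      by_cases hy : y ∈ s
      · simp [Set.indicator, hy, h2 y]
      · simp [Set.indicator, hy]
    simp_rw [this]
    exact lintegral_indicator_one hs

/-- One half of the Schrödinger system makes the density have total mass one, whatever the first
marginal is. -/
theorem lintegral_exp_potentialLogDensity [IsProbabilityMeasure μ] [IsProbabilityMeasure ν]
    (hd : Measurable (Function.uncurry d)) (ha : Measurable a) (hb : Measurable b)
    (h1 : ∀ x, ∫⁻ y, ENNReal.ofReal (Real.exp (potentialLogDensity d ε a b (x, y))) ∂ν = 1) :
    ∫⁻ z, ENNReal.ofReal (Real.exp (potentialLogDensity d ε a b z)) ∂(μ.prod ν) = 1 := by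
  have hm : Measurable (potentialLogDensity d ε a b) :=
    (((ha.comp measurable_fst).add (hb.comp measurable_snd)).sub hd).div_const ε
  rw [lintegral_prod _ (by fun_prop)]
  simp [h1]

theorem lintegral_exp_potentialLogDensity' [IsProbabilityMeasure μ] [IsProbabilityMeasure ν]
    (hd : Measurable (Function.uncurry d)) (ha : Measurable a) (hb : Measurable b)
    (h2 : ∀ y, ∫⁻ x, ENNReal.ofReal (Real.exp (potentialLogDensity d ε a b (x, y))) ∂μ = 1) :
    ∫⁻ z, ENNReal.ofReal (Real.exp (potentialLogDensity d ε a b z)) ∂(μ.prod ν) = 1 := by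
  have hm : Measurable (potentialLogDensity d ε a b) :=
    (((ha.comp measurable_fst).add (hb.comp measurable_snd)).sub hd).div_const ε
  rw [lintegral_prod_symm _ (by fun_prop)]
  simp [h2]

theorem integrable_exp_of_lintegral_eq_one {α : Type*} [MeasurableSpace α] {π : Measure α}
    {h : α → ℝ} (hm : Measurable h) (h1 : ∫⁻ z, ENNReal.ofReal (Real.exp (h z)) ∂π = 1) :
    Integrable (fun z => Real.exp (h z)) π ∧ ∫ z, Real.exp (h z) ∂π = 1 := by
  have hi : Integrable (fun z => Real.exp (h z)) π :=
    (lintegral_ofReal_ne_top_iff_integrable (by fun_prop)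
      (Filter.Eventually.of_forall fun z => (Real.exp_pos _).le)).1 (by simp [h1])
  refine ⟨hi, ?_⟩
  rw [integral_eq_lintegral_of_nonneg_ae
    (Filter.Eventually.of_forall fun z => (Real.exp_pos _).le) hi.aestronglyMeasurable, h1]
  rfl

/-- Dual lower bound for the entropic cost. -/
theorem ofReal_add_integral_le_entropicOT [IsProbabilityMeasure μ] [IsProbabilityMeasure ν]
    (hε : 0 < ε) (hd : Measurable (Function.uncurry d)) (hd0 : ∀ x y, 0 ≤ d x y)
    (ham : Measurable a) (hbm : Measurable b) (ha : Integrable a μ) (hb : Integrable b ν)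
    (h1 : ∫⁻ z, ENNReal.ofReal (Real.exp (potentialLogDensity d ε a b z)) ∂(μ.prod ν) = 1) :
    ENNReal.ofReal (∫ x, a x ∂μ + ∫ y, b y ∂ν)
      ≤ entropicOT (fun x y => ENNReal.ofReal (d x y)) ε μ ν := by
  have hm : Measurable (potentialLogDensity d ε a b) :=
    (((ham.comp measurable_fst).add (hbm.comp measurable_snd)).sub hd).div_const ε
  obtain ⟨hexp, hone⟩ := integrable_exp_of_lintegral_eq_one hm h1
  exact le_iInf₂ fun γ hγ => ofReal_add_integral_le_cost hε hd hd0 ha hb hexp hone hγ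

/-- Solutions of the Schrödinger system compute the entropic cost. -/
theorem entropicOT_toReal_eq [IsProbabilityMeasure μ] [IsProbabilityMeasure ν]
    (hε : 0 < ε) (hd : Measurable (Function.uncurry d)) (hd0 : ∀ x y, 0 ≤ d x y)
    (ham : Measurable a) (hbm : Measurable b) (ha : Integrable a μ) (hb : Integrable b ν)
    {f g : E → ℝ} (hf : Integrable f μ) (hg : Integrable g ν) (hdfg : ∀ x y, d x y ≤ f x + g y)
    (h1 : ∀ x, ∫⁻ y, ENNReal.ofReal (Real.exp (potentialLogDensity d ε a b (x, y))) ∂ν = 1)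
    (h2 : ∀ y, ∫⁻ x, ENNReal.ofReal (Real.exp (potentialLogDensity d ε a b (x, y))) ∂μ = 1) :
    (entropicOT (fun x y => ENNReal.ofReal (d x y)) ε μ ν).toReal
      = ∫ x, a x ∂μ + ∫ y, b y ∂ν := by
  have hm : Measurable (potentialLogDensity d ε a b) :=
    (((ham.comp measurable_fst).add (hbm.comp measurable_snd)).sub hd).div_const ε
  have hmass := lintegral_exp_potentialLogDensity (μ := μ) hd ham hbm h1
  obtain ⟨hexp, hone⟩ := integrable_exp_of_lintegral_eq_one hm hmass
  have hlow := ofReal_add_integral_le_entropicOT hε hd hd0 ham hbm ha hb hmass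
  set γ := (μ.prod ν).tilted (potentialLogDensity d ε a b) with hγdef
  have hγ : IsCoupling γ μ ν := by
    have := isCoupling_withDensity hd ham hbm h1 h2
    simpa [hγdef, Measure.tilted, hone] using this
  have := hγ.isProbabilityMeasure
  -- The domination `d ≤ f ⊕ g` depends only on the marginals of `γ`, so it makes the transport cost
  -- finite.
  have hdint : Integrable (fun z : E × E => d z.1 z.2) γ := by
    refine (hγ.integrable_add hf hg).mono' hd.aestronglyMeasurable
      (Filter.Eventually.of_forall fun z => ?_)
    rw [Real.norm_of_nonneg (hd0 _ _)]
    exact hdfg _ _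
  have hab := hγ.integrable_add ha hb
  have hh : Integrable (potentialLogDensity d ε a b) γ := (hab.sub hdint).div_const ε
  have hac : γ ≪ μ.prod ν := tilted_absolutelyContinuous _ _
  have hllr : llr γ (μ.prod ν) =ᵐ[γ] potentialLogDensity d ε a b := by
    filter_upwards [hac.ae_le (log_rnDeriv_tilted_left_self hexp)] with z hz
    exact hz.trans (by simp [hone])
  have hllri : Integrable (llr γ (μ.prod ν)) γ := (integrable_congr hllr).2 hh
  have hval : ∫ z, potentialLogDensity d ε a b z ∂γ
      = (∫ x, a x ∂μ + ∫ y, b y ∂ν - ∫ z, d z.1 z.2 ∂γ) / ε := by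
    simp only [potentialLogDensity]
    rw [integral_div, integral_sub hab hdint, hγ.integral_add ha hb]
  have hkl : InformationTheory.klDiv γ (μ.prod ν)
      = ENNReal.ofReal (∫ z, potentialLogDensity d ε a b z ∂γ) := by
    rw [InformationTheory.klDiv_of_ac_of_integrable hac hllri, integral_congr_ae hllr]
    simp
  have hkl0 : 0 ≤ ∫ z, potentialLogDensity d ε a b z ∂γ := by
    have := InformationTheory.integral_llr_add_sub_measure_univ_nonneg hac hllri
    rw [integral_congr_ae hllr] at this
    simpa using this
  have hd0' : 0 ≤ ∫ z, d z.1 z.2 ∂γ := integral_nonneg fun z => hd0 _ _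
  have hcost : ∫⁻ z, ENNReal.ofReal (d z.1 z.2) ∂γ
        + ENNReal.ofReal ε * InformationTheory.klDiv γ (μ.prod ν)
      = ENNReal.ofReal (∫ x, a x ∂μ + ∫ y, b y ∂ν) := by
    rw [hkl, ← ofReal_integral_eq_lintegral_ofReal hdint
      (Filter.Eventually.of_forall fun z => hd0 z.1 z.2), ← ENNReal.ofReal_mul hε.le,
      ← ENNReal.ofReal_add hd0' (mul_nonneg hε.le hkl0), hval, mul_div_cancel₀ _ hε.ne']
    congr 1
    ring
  have hup : entropicOT (fun x y => ENNReal.ofReal (d x y)) ε μ ν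
      ≤ ENNReal.ofReal (∫ x, a x ∂μ + ∫ y, b y ∂ν) :=
    hcost ▸ iInf₂_le γ hγ
  rw [le_antisymm hup hlow, ENNReal.toReal_ofReal]
  -- The dual value is nonnegative, being transport cost plus `ε` times a divergence, so
  -- `ENNReal.ofReal` has not truncated it.
  rw [hval, le_div_iff₀ hε] at hkl0
  linarith

end Duality

/-! ### Exponential integrals against the standard Gaussian measure. -/

section GaussianIntegral

open Matrix WithLp
open scoped RealInnerProductSpace

variable {m : ℕ}

/-- The complex moment generating function of the standard Gaussian measure. -/
theorem integral_cexp_stdGaussian (z : Fin m → ℂ) :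
    ∫ x, Complex.exp (∑ i, z i * (x i : ℂ)) ∂(stdGaussian (EuclideanSpace ℝ (Fin m)))
      = Complex.exp ((∑ i, z i ^ 2) / 2) := by
  rw [← map_pi_eq_stdGaussian, integral_map (Measurable.aemeasurable (by fun_prop))
    (Measurable.aestronglyMeasurable (by fun_prop))]
  simp_rw [Complex.exp_sum,
    integral_fintype_prod_eq_prod (f := fun i (x : ℝ) ↦ Complex.exp (z i * (x : ℂ)))]
  have h : ∀ i, ∫ x : ℝ, Complex.exp (z i * (x : ℂ)) ∂(gaussianReal 0 1)
      = Complex.exp (z i ^ 2 / 2) := by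
    intro i
    have := complexMGF_id_gaussianReal (μ := 0) (v := 1) (z i)
    simpa [complexMGF] using this
  simp_rw [h]
  rw [← Complex.exp_sum, Finset.sum_div]

theorem integral_exp_inner_stdGaussian (t : EuclideanSpace ℝ (Fin m)) :
    ∫ x, Real.exp ⟪t, x⟫ ∂(stdGaussian (EuclideanSpace ℝ (Fin m))) = Real.exp (‖t‖ ^ 2 / 2) := by
  have h := integral_cexp_stdGaussian (m := m) (fun i => (t i : ℂ))
  have h1 : ∀ x : EuclideanSpace ℝ (Fin m), Complex.exp (∑ i, (t i : ℂ) * (x i : ℂ))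
      = ((Real.exp ⟪t, x⟫ : ℝ) : ℂ) := by
    intro x
    simp [PiLp.inner_apply, mul_comm]
  have h2 : Complex.exp ((∑ i, (t i : ℂ) ^ 2) / 2) = ((Real.exp (‖t‖ ^ 2 / 2) : ℝ) : ℂ) := by
    simp [EuclideanSpace.real_norm_sq_eq]
  simp_rw [h1] at h
  rw [h2, integral_complex_ofReal] at h
  exact_mod_cast h

/-- A non-integrable function has Bochner integral zero, while the computed integral is strictly
positive. -/
theorem integrable_exp_inner_stdGaussian (t : EuclideanSpace ℝ (Fin m)) :
    Integrable (fun x => Real.exp ⟪t, x⟫) (stdGaussian (EuclideanSpace ℝ (Fin m))) := by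
  by_contra h
  have := integral_exp_inner_stdGaussian t
  rw [integral_undef h] at this
  exact absurd this (Real.exp_pos _).ne

/-- Cameron–Martin: translating the standard Gaussian measure amounts to tilting it. -/
theorem tilted_inner_stdGaussian (t : EuclideanSpace ℝ (Fin m)) :
    (stdGaussian (EuclideanSpace ℝ (Fin m))).tilted (fun x => ⟪t, x⟫) = (stdGaussian (EuclideanSpace ℝ (Fin m))).map (fun x => x + t) := by
  have := isProbabilityMeasure_tilted (integrable_exp_inner_stdGaussian t)
  have : IsFiniteMeasure ((stdGaussian (EuclideanSpace ℝ (Fin m))).map (fun x => x + t)) := inferInstance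
  apply Measure.ext_of_charFun (E := EuclideanSpace ℝ (Fin m))
  ext s
  rw [charFun_map_add_const, charFun_stdGaussian, charFun_apply, integral_tilted,
    integral_exp_inner_stdGaussian]
  -- The characteristic function of the tilted measure at `s` is the complex moment generating
  -- function at `t + i s`, up to normalization.
  have h1 : ∀ x : EuclideanSpace ℝ (Fin m), (Real.exp ⟪t, x⟫ / Real.exp (‖t‖ ^ 2 / 2)) • Complex.exp (⟪x, s⟫ * Complex.I)
      = Complex.exp (-‖t‖ ^ 2 / 2)
        * Complex.exp (∑ i, ((t i : ℂ) + s i * Complex.I) * (x i : ℂ)) := by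
    intro x
    rw [← Real.exp_sub, Complex.real_smul, Complex.ofReal_exp, ← Complex.exp_add,
      ← Complex.exp_add]
    congr 1
    simp only [PiLp.inner_apply, add_mul, Finset.sum_add_distrib]
    push_cast
    simp [mul_comm]
    simp only [Finset.mul_sum]
    ring_nf
  simp_rw [h1]
  rw [integral_const_mul, integral_cexp_stdGaussian, ← Complex.exp_add, ← Complex.exp_add]
  congr 1
  have h2 : ∑ i, ((t i : ℂ) + s i * Complex.I) ^ 2
      = ∑ i, (t i : ℂ) ^ 2 - ∑ i, (s i : ℂ) ^ 2 + 2 * (∑ i, (s i : ℂ) * t i) * Complex.I := by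
    rw [Finset.mul_sum, Finset.sum_mul, ← Finset.sum_sub_distrib, ← Finset.sum_add_distrib]
    refine Finset.sum_congr rfl fun i _ => ?_
    linear_combination (s i : ℂ) ^ 2 * Complex.I_sq
  rw [h2]
  simp only [← Complex.ofReal_pow, EuclideanSpace.real_norm_sq_eq, PiLp.inner_apply]
  push_cast
  simp [mul_comm]
  ring

theorem lintegral_add_stdGaussian (t : EuclideanSpace ℝ (Fin m)) {f : EuclideanSpace ℝ (Fin m) → ℝ≥0∞} (hf : Measurable f) :
    ∫⁻ x, f (x + t) ∂(stdGaussian (EuclideanSpace ℝ (Fin m)))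
      = ∫⁻ x, ENNReal.ofReal (Real.exp (⟪t, x⟫ - ‖t‖ ^ 2 / 2)) * f x ∂(stdGaussian (EuclideanSpace ℝ (Fin m))) := by
  rw [← lintegral_map (μ := stdGaussian (EuclideanSpace ℝ (Fin m))) (g := fun x => x + t) hf (by fun_prop),
    ← tilted_inner_stdGaussian, lintegral_tilted, integral_exp_inner_stdGaussian]
  simp_rw [Real.exp_sub]

/-- Gaussian integral of the exponential of a quadratic polynomial, by completing the square. -/
theorem lintegral_exp_quadratic_stdGaussian {P : Matrix (Fin m) (Fin m) ℝ} (hP : P.IsSymm)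
    {w t : EuclideanSpace ℝ (Fin m)} (htw : t.ofLp + P *ᵥ t.ofLp = w.ofLp) :
    ∫⁻ v, ENNReal.ofReal (Real.exp (-(v.ofLp ⬝ᵥ P *ᵥ v.ofLp) / 2 + ⟪w, v⟫)) ∂(stdGaussian (EuclideanSpace ℝ (Fin m)))
      = ENNReal.ofReal (Real.exp (⟪w, t⟫ / 2))
        * ∫⁻ v, ENNReal.ofReal (Real.exp (-(v.ofLp ⬝ᵥ P *ᵥ v.ofLp) / 2)) ∂(stdGaussian (EuclideanSpace ℝ (Fin m))) := by
  have hmeas : Measurable fun v : EuclideanSpace ℝ (Fin m) => v.ofLp ⬝ᵥ P *ᵥ v.ofLp := by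
    simp only [← inner_toEuclideanCLM]
    fun_prop
  rw [← lintegral_const_mul _ (by fun_prop)]
  -- The function is the target integrand divided by the Cameron–Martin density. After translation
  -- by `t`, the equation `(1 + P) t = w` cancels all terms linear in `v`.
  have hCM := lintegral_add_stdGaussian t (f := fun u => ENNReal.ofReal (Real.exp
    (-(u.ofLp ⬝ᵥ P *ᵥ u.ofLp) / 2 + ⟪w, u⟫ - ⟪t, u⟫ + ‖t‖ ^ 2 / 2))) (by fun_prop)
  have e1 : ∀ v : EuclideanSpace ℝ (Fin m), ENNReal.ofReal (Real.exp (⟪t, v⟫ - ‖t‖ ^ 2 / 2)) * ENNReal.ofReal (Real.exp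
      (-(v.ofLp ⬝ᵥ P *ᵥ v.ofLp) / 2 + ⟪w, v⟫ - ⟪t, v⟫ + ‖t‖ ^ 2 / 2))
      = ENNReal.ofReal (Real.exp (-(v.ofLp ⬝ᵥ P *ᵥ v.ofLp) / 2 + ⟪w, v⟫)) := by
    intro v
    rw [← ENNReal.ofReal_mul (Real.exp_pos _).le, ← Real.exp_add]
    ring_nf
  simp_rw [e1] at hCM
  rw [← hCM]
  refine lintegral_congr fun v => ?_
  rw [← ENNReal.ofReal_mul (Real.exp_pos _).le, ← Real.exp_add]
  congr 2
  have hw : w = t + toEuclideanCLM (𝕜 := ℝ) P t := by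
    apply (WithLp.ofLp_injective 2)
    simp [← htw]
  have hsymm : ∀ x y : EuclideanSpace ℝ (Fin m), ⟪x, toEuclideanCLM (𝕜 := ℝ) P y⟫ = ⟪y, toEuclideanCLM (𝕜 := ℝ) P x⟫ := by
    intro x y
    rw [inner_toEuclideanCLM, inner_toEuclideanCLM, dotProduct_mulVec, ← mulVec_transpose, hP,
      dotProduct_comm]
  simp only [← inner_toEuclideanCLM, hw, inner_add_left, inner_add_right, map_add,
    ← real_inner_self_eq_norm_sq]
  rw [real_inner_comm v (toEuclideanCLM (𝕜 := ℝ) P t), real_inner_comm t (toEuclideanCLM (𝕜 := ℝ) P t),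
    hsymm t v]
  ring

end GaussianIntegral

/-! ### Hilbert–Schmidt estimates and the matrix Schrödinger system. -/

section Matrices

open Matrix WithLp
open scoped RealInnerProductSpace MatrixOrder

variable {m : ℕ}

/-- A square matrix as an element of a Euclidean space, whose norm is the Hilbert–Schmidt norm. -/
noncomputable def hsVec (A : Matrix (Fin m) (Fin m) ℝ) : EuclideanSpace ℝ (Fin m × Fin m) :=
  toLp 2 fun p => A p.1 p.2

/-- The Hilbert–Schmidt norm. -/
noncomputable def hsNorm (A : Matrix (Fin m) (Fin m) ℝ) : ℝ := ‖hsVec A‖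

theorem hsNorm_nonneg (A : Matrix (Fin m) (Fin m) ℝ) : 0 ≤ hsNorm A := norm_nonneg _

theorem hsNorm_sq (A : Matrix (Fin m) (Fin m) ℝ) : hsNorm A ^ 2 = ∑ i, ∑ j, A i j ^ 2 := by
  rw [hsNorm, EuclideanSpace.real_norm_sq_eq, Fintype.sum_prod_type]
  rfl

theorem hsNorm_sub_comm (A B : Matrix (Fin m) (Fin m) ℝ) : hsNorm (A - B) = hsNorm (B - A) :=
  norm_sub_rev (hsVec A) (hsVec B)

theorem hsNorm_le_add_sub (A B : Matrix (Fin m) (Fin m) ℝ) :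
    hsNorm A ≤ hsNorm B + hsNorm (A - B) :=
  norm_le_norm_add_norm_sub' (hsVec A) (hsVec B)

theorem inner_hsVec (A B : Matrix (Fin m) (Fin m) ℝ) :
    ⟪hsVec A, hsVec B⟫ = (Aᵀ * B).trace := by
  rw [PiLp.inner_apply, Fintype.sum_prod_type, Finset.sum_comm]
  simp [hsVec, trace, Matrix.mul_apply, mul_comm]

theorem abs_trace_mul_le {A : Matrix (Fin m) (Fin m) ℝ} (hA : A.IsSymm)
    (B : Matrix (Fin m) (Fin m) ℝ) : |(A * B).trace| ≤ hsNorm A * hsNorm B := by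
  have := abs_real_inner_le_norm (hsVec A) (hsVec B)
  rwa [inner_hsVec, hA] at this

theorem isSymm_of_posSemidef {A : Matrix (Fin m) (Fin m) ℝ} (hA : A.PosSemidef) : A.IsSymm := by
  simpa [Matrix.IsHermitian, Matrix.IsSymm, conjTranspose_eq_transpose_of_trivial] using hA.1

theorem sqrt_mul_sqrt {A : Matrix (Fin m) (Fin m) ℝ} (hA : A.PosSemidef) :
    CFC.sqrt A * CFC.sqrt A = A := CFC.sqrt_mul_sqrt_self _ hA.nonneg

theorem posSemidef_sqrt (A : Matrix (Fin m) (Fin m) ℝ) : (CFC.sqrt A).PosSemidef :=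
  nonneg_iff_posSemidef.1 (CFC.sqrt_nonneg A)

theorem posSemidef_transpose_mul_mul {A : Matrix (Fin m) (Fin m) ℝ} (hA : A.PosSemidef)
    (B : Matrix (Fin m) (Fin m) ℝ) : (Bᵀ * A * B).PosSemidef := by
  simpa [conjTranspose_eq_transpose_of_trivial] using hA.conjTranspose_mul_mul_same B

/-- By cyclicity the trace is that of `√A B √A`, which is positive semidefinite. -/
theorem trace_mul_nonneg {A B : Matrix (Fin m) (Fin m) ℝ} (hA : A.PosSemidef)
    (hB : B.PosSemidef) : 0 ≤ (A * B).trace := by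
  have h := (posSemidef_transpose_mul_mul hB (CFC.sqrt A)).trace_nonneg
  rwa [isSymm_of_posSemidef (posSemidef_sqrt A), Matrix.trace_mul_comm, ← Matrix.mul_assoc,
    sqrt_mul_sqrt hA] at h

/-- The Hilbert–Schmidt norm is monotone on positive semidefinite matrices. -/
theorem hsNorm_le_of_posSemidef_sub {R B : Matrix (Fin m) (Fin m) ℝ} {c : ℝ} (hc : 0 ≤ c)
    (hR : R.PosSemidef) (hRB : (c • B - R).PosSemidef) : hsNorm R ≤ c * hsNorm B := by
  have hs := isSymm_of_posSemidef hR
  -- From `tr (R (c B - R)) ≥ 0` follows `‖R‖² ≤ c tr (R B) ≤ c ‖R‖ ‖B‖`; dividing by `‖R‖`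
  -- concludes.
  have h1 := trace_mul_nonneg hR hRB
  have h2 : hsNorm R ^ 2 = (R * R).trace := by
    rw [hsNorm, ← real_inner_self_eq_norm_sq, inner_hsVec, hs]
  rw [Matrix.mul_sub, Matrix.trace_sub, Matrix.mul_smul, Matrix.trace_smul, ← h2,
    smul_eq_mul] at h1
  have h3 := mul_le_mul_of_nonneg_left ((le_abs_self _).trans (abs_trace_mul_le hs B)) hc
  rcases (hsNorm_nonneg R).eq_or_lt with h0 | h0
  · rw [← h0]
    exact mul_nonneg hc (hsNorm_nonneg B)
  · refine le_of_mul_le_mul_left ?_ h0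
    nlinarith

/-- For `W ≥ 0`, the inverse `G` of `1 + W` satisfies `0 ≤ G ≤ 1`. -/
theorem posSemidef_of_mul_one_add {W G : Matrix (Fin m) (Fin m) ℝ} (hW : W.PosSemidef)
    (hG : G * (1 + W) = 1) : G.PosSemidef ∧ (1 - G).PosSemidef := by
  have hW1 : (1 + W).PosDef := PosDef.one.add_posSemidef hW
  have hGi : G = (1 + W)⁻¹ := (Matrix.inv_eq_left_inv hG).symm
  have hGp : G.PosSemidef := hGi ▸ hW1.inv.posSemidef
  have hG' : (1 + W) * G = 1 := mul_eq_one_comm.1 hG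
  refine ⟨hGp, ?_⟩
  -- Positivity of `1 - G` will follow from `1 - G = G W = G (W + W²) G`, a congruence of this
  -- matrix.
  have hWW : (W + W * W).PosSemidef := by
    refine hW.add ?_
    have := posSemidef_transpose_mul_mul (PosSemidef.one (n := Fin m) (R := ℝ)) W
    rwa [isSymm_of_posSemidef hW, Matrix.mul_one] at this
  have := posSemidef_transpose_mul_mul hWW G
  rw [isSymm_of_posSemidef hGp] at this
  convert this using 1
  calc 1 - G = G * W := by rw [sub_eq_iff_eq_add, ← hG]; noncomm_ring
    _ = G * W * ((1 + W) * G) := by rw [hG', Matrix.mul_one]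
    _ = G * (W + W * W) * G := by noncomm_ring

theorem isUnit_one_add {W : Matrix (Fin m) (Fin m) ℝ} (hW : W.PosSemidef) :
    (1 + W)⁻¹ * (1 + W) = 1 :=
  Matrix.nonsing_inv_mul _ ((Matrix.isUnit_iff_isUnit_det _).1
    (PosDef.one.add_posSemidef hW).isUnit)

/-- The algebraic form of the Schrödinger system between two Gaussian measures is solvable. -/
theorem exists_matrix_schrodinger (S : Matrix (Fin m) (Fin m) ℝ) {c : ℝ} (hc : 0 < c) :
    ∃ G H : Matrix (Fin m) (Fin m) ℝ, G.PosSemidef ∧ H.PosSemidef ∧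
      (1 - G).PosSemidef ∧ (1 - H).PosSemidef ∧
      G * (1 + c • (Sᵀ * H * S)) = 1 ∧ H * (1 + c • (S * G * Sᵀ)) = 1 := by
  set L := Sᵀ * S with hL
  have hLp : L.PosSemidef := by
    have := posSemidef_transpose_mul_mul (PosSemidef.one (n := Fin m) (R := ℝ)) S
    rwa [Matrix.mul_one] at this
  -- Eliminating `H` leads to the quadratic equation `G + c G² L = 1`. Its scalar positive root is
  -- `2 / (1 + √(1 + 4 c l))`, which dictates `D` and then `G`; this form needs no inverse of `L`.
  set D := CFC.sqrt (1 + (4 * c) • L) with hD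
  have hDp : D.PosSemidef := posSemidef_sqrt _
  have hDD : D * D = 1 + (4 * c) • L :=
    sqrt_mul_sqrt (PosSemidef.one.add (hLp.smul (by positivity)))
  have hI : (1 + D)⁻¹ * (1 + D) = 1 := isUnit_one_add hDp
  set G := (2 : ℝ) • (1 + D)⁻¹ with hG
  have hGD : G * (1 + D) = (2 : ℝ) • 1 := by rw [hG, Matrix.smul_mul, hI]
  have hGp : G.PosSemidef :=
    (PosDef.one.add_posSemidef hDp).inv.posSemidef.smul (by norm_num)
  clear_value G
  have hSGS : (S * G * Sᵀ).PosSemidef := by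
    simpa using posSemidef_transpose_mul_mul hGp Sᵀ
  have hH : (1 + c • (S * G * Sᵀ))⁻¹ * (1 + c • (S * G * Sᵀ)) = 1 :=
    isUnit_one_add (hSGS.smul hc.le)
  set H := (1 + c • (S * G * Sᵀ))⁻¹ with hHdef
  have hHp : H.PosSemidef := (PosDef.one.add_posSemidef (hSGS.smul hc.le)).inv.posSemidef
  have hGH : G * (1 + c • (Sᵀ * H * S)) = 1 := by
    have hquad : G + c • (G * G * L) = 1 := by
      have h1 : (4 : ℝ) • (c • (G * G * L)) = (4 : ℝ) • (1 - G) := by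
        calc (4 : ℝ) • (c • (G * G * L)) = G * G * ((1 + (4 * c) • L) - 1) := by
              rw [add_sub_cancel_left, Matrix.mul_smul, ← smul_smul]
          _ = G * (G * (1 + D)) * (D - 1) := by rw [← hDD]; noncomm_ring
          _ = (2 : ℝ) • (G * (1 + D) - (2 : ℝ) • G) := by
              rw [hGD, Matrix.mul_smul, Matrix.smul_mul, Matrix.mul_one, ← hGD]
              rw [two_smul ℝ G]; noncomm_ring
          _ = (4 : ℝ) • (1 - G) := by
              rw [hGD, ← smul_sub, smul_smul]; norm_num
      have h2 : c • (G * G * L) = 1 - G := smul_right_injective _ (by norm_num : (4 : ℝ) ≠ 0) h1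
      rw [h2]; abel
    -- Push-through identity: it moves `S` across the inverse `H`, so that the second equation can
    -- be inserted into the first.
    have hcomm : (1 + c • (S * G * Sᵀ)) * S = S * (1 + c • (G * L)) := by
      rw [hL]
      simp only [Matrix.add_mul, Matrix.mul_add, Matrix.smul_mul, Matrix.mul_smul, Matrix.one_mul,
        Matrix.mul_one, Matrix.mul_assoc]
    have hHS : S = H * S * (1 + c • (G * L)) := by
      calc S = H * (1 + c • (S * G * Sᵀ)) * S := by rw [hH, Matrix.one_mul]
        _ = H * S * (1 + c • (G * L)) := by rw [Matrix.mul_assoc, hcomm, Matrix.mul_assoc]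
    have hkey : G * (1 + c • (Sᵀ * H * S)) * (1 + c • (G * L)) = 1 + c • (G * L) := by
      calc G * (1 + c • (Sᵀ * H * S)) * (1 + c • (G * L))
          = G * (1 + c • (G * L)) + c • (G * (Sᵀ * (H * S * (1 + c • (G * L))))) := by
            simp only [Matrix.add_mul, Matrix.mul_add, Matrix.smul_mul, Matrix.mul_smul,
              Matrix.mul_one, Matrix.mul_assoc, smul_add]
            abel
        _ = (G + c • (G * G * L)) + c • (G * L) := by
            rw [← hHS, ← hL, Matrix.mul_add, Matrix.mul_one, Matrix.mul_smul, Matrix.mul_assoc]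
        _ = 1 + c • (G * L) := by rw [hquad]
    -- `G L` need not be symmetric. Sylvester's identity `det (1 + X Y) = det (1 + Y X)` transfers
    -- invertibility from the positive definite `1 + c S G Sᵀ`.
    have hinv : IsUnit (1 + c • (G * L)) := by
      rw [Matrix.isUnit_iff_isUnit_det]
      have hdet : (1 + c • (G * L)).det = (1 + c • (S * G * Sᵀ)).det := by
        have := Matrix.det_one_add_mul_comm (c • (G * Sᵀ)) S
        rw [hL]
        simpa [Matrix.mul_assoc] using this
      rw [hdet, ← Matrix.isUnit_iff_isUnit_det]
      exact (PosDef.one.add_posSemidef (hSGS.smul hc.le)).isUnit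
    exact hinv.mul_right_cancel (by rw [hkey, Matrix.one_mul])
  have hW1 : (c • (Sᵀ * H * S)).PosSemidef := (posSemidef_transpose_mul_mul hHp S).smul hc.le
  exact ⟨G, H, hGp, hHp, (posSemidef_of_mul_one_add hW1 hGH).2,
    (posSemidef_of_mul_one_add (hSGS.smul hc.le) hH).2, hGH, hH⟩

end Matrices

/-! ### Schrödinger potentials between centered Gaussian measures. -/

section GaussianPotentials

open Matrix WithLp
open scoped RealInnerProductSpace MatrixOrder

variable {m : ℕ}

theorem measurable_quadratic (M : Matrix (Fin m) (Fin m) ℝ) :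
    Measurable fun v : EuclideanSpace ℝ (Fin m) => v.ofLp ⬝ᵥ M *ᵥ v.ofLp := by
  simp only [← inner_toEuclideanCLM]
  fun_prop

theorem norm_sq_eq_dotProduct (x : EuclideanSpace ℝ (Fin m)) :
    ‖x‖ ^ 2 = x.ofLp ⬝ᵥ (1 : Matrix (Fin m) (Fin m) ℝ) *ᵥ x.ofLp := by
  rw [EuclideanSpace.real_norm_sq_eq, one_mulVec]
  simp [dotProduct, pow_two]

theorem memLp_eval_multivariateGaussian (A : Matrix (Fin m) (Fin m) ℝ) (i : Fin m) :
    MemLp (fun x : EuclideanSpace ℝ (Fin m) => x i) 2 (multivariateGaussian 0 A) :=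
  (IsGaussian.memLp_two_id (μ := multivariateGaussian 0 A)).eval_piLp i

theorem integrable_quadratic_multivariateGaussian (A M : Matrix (Fin m) (Fin m) ℝ) :
    Integrable (fun x => x.ofLp ⬝ᵥ M *ᵥ x.ofLp) (multivariateGaussian 0 A) := by
  simp only [dotProduct, mulVec, Finset.mul_sum]
  refine integrable_finsetSum _ fun i _ => integrable_finsetSum _ fun j _ => ?_
  have := ((memLp_eval_multivariateGaussian A i).integrable_mul
    (memLp_eval_multivariateGaussian A j)).const_mul (M i j)
  refine this.congr (Filter.Eventually.of_forall fun x => ?_)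
  simp only [Pi.mul_apply]
  ring

theorem integral_eval_mul_eval_multivariateGaussian {A : Matrix (Fin m) (Fin m) ℝ}
    (hA : A.PosSemidef) (i j : Fin m) :
    ∫ x : EuclideanSpace ℝ (Fin m), x i * x j ∂(multivariateGaussian 0 A) = A i j := by
  have hz : ∀ k, ∫ x : EuclideanSpace ℝ (Fin m), x k ∂(multivariateGaussian 0 A) = 0 := by
    intro k
    have := (EuclideanSpace.proj (𝕜 := ℝ) k).integral_comp_comm
      (IsGaussian.integrable_fun_id (μ := multivariateGaussian 0 A))
    simpa using this
  have h := covariance_eval_multivariateGaussian (μ := 0) hA i j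
  rw [covariance_eq_sub (memLp_eval_multivariateGaussian A i)
    (memLp_eval_multivariateGaussian A j), hz, zero_mul, sub_zero] at h
  exact h

theorem integral_quadratic_multivariateGaussian {A : Matrix (Fin m) (Fin m) ℝ}
    (hA : A.PosSemidef) (M : Matrix (Fin m) (Fin m) ℝ) :
    ∫ x, x.ofLp ⬝ᵥ M *ᵥ x.ofLp ∂(multivariateGaussian 0 A) = (M * A).trace := by
  have hi : ∀ i j, Integrable (fun x : EuclideanSpace ℝ (Fin m) => x i * (M i j * x j))
      (multivariateGaussian 0 A) := fun i j =>
    (memLp_eval_multivariateGaussian A i).integrable_mul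
      ((memLp_eval_multivariateGaussian A j).const_mul (M i j))
  simp only [dotProduct, mulVec, Finset.mul_sum]
  rw [integral_finsetSum _ fun i _ => integrable_finsetSum _ fun j _ => hi i j]
  simp only [trace, diag_apply, Matrix.mul_apply]
  refine Finset.sum_congr rfl fun i _ => ?_
  rw [integral_finsetSum _ fun j _ => hi i j]
  refine Finset.sum_congr rfl fun j _ => ?_
  simp_rw [mul_left_comm _ (M i j)]
  rw [integral_const_mul, integral_eval_mul_eval_multivariateGaussian hA,
    (isSymm_of_posSemidef hA).apply]

/-- The normalizing constant `𝔼 exp (-vᵀ P v / 2)` for a standard Gaussian vector `v`. -/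
noncomputable def gaussianMass (P : Matrix (Fin m) (Fin m) ℝ) : ℝ≥0∞ :=
  ∫⁻ v, ENNReal.ofReal (Real.exp (-(v.ofLp ⬝ᵥ P *ᵥ v.ofLp) / 2))
    ∂(stdGaussian (EuclideanSpace ℝ (Fin m)))

theorem gaussianMass_ne_zero (P : Matrix (Fin m) (Fin m) ℝ) : gaussianMass P ≠ 0 := by
  have hm := measurable_quadratic P
  rw [gaussianMass, Ne, lintegral_eq_zero_iff (by fun_prop)]
  intro h
  obtain ⟨v, hv⟩ := h.exists
  exact (ENNReal.ofReal_pos.2 (Real.exp_pos _)).ne' hv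

theorem gaussianMass_ne_top {P : Matrix (Fin m) (Fin m) ℝ} (hP : P.PosSemidef) :
    gaussianMass P ≠ ⊤ := by
  refine ne_top_of_le_ne_top (b := ∫⁻ _, 1 ∂(stdGaussian (EuclideanSpace ℝ (Fin m)))) (by simp)
    (lintegral_mono fun v => ?_)
  rw [← ENNReal.ofReal_one]
  refine ENNReal.ofReal_le_ofReal (Real.exp_le_one_iff.2 ?_)
  have := hP.dotProduct_mulVec_nonneg v.ofLp
  simp only [star_trivial] at this
  linarith

/-- Writing `y = √B v` with `v` standard Gaussian reduces to completing the square with `P = √B Q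
√B`; the shift is `t = G (c √B x)` because `G` inverts `1 + P`. The result is again Gaussian in `x`,
which is why quadratic potentials close the system. -/
theorem lintegral_exp_quadratic_multivariateGaussian (B : Matrix (Fin m) (Fin m) ℝ)
    {Q G : Matrix (Fin m) (Fin m) ℝ} (hQ : Q.IsSymm)
    (hG : G * (1 + CFC.sqrt B * Q * CFC.sqrt B) = 1) (c : ℝ) (x : EuclideanSpace ℝ (Fin m)) :
    ∫⁻ y, ENNReal.ofReal (Real.exp (-(y.ofLp ⬝ᵥ Q *ᵥ y.ofLp) / 2 + c * ⟪x, y⟫))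
        ∂(multivariateGaussian 0 B)
      = ENNReal.ofReal (Real.exp
          ((x.ofLp ⬝ᵥ (c ^ 2 • (CFC.sqrt B * G * CFC.sqrt B)) *ᵥ x.ofLp) / 2))
        * gaussianMass (CFC.sqrt B * Q * CFC.sqrt B) := by
  have hm := measurable_quadratic Q
  set s := CFC.sqrt B with hs
  have hsT : sᵀ = s := isSymm_of_posSemidef (posSemidef_sqrt B)
  have hPs : (s * Q * s).IsSymm := by
    rw [Matrix.IsSymm, transpose_mul, transpose_mul, hsT, hQ, Matrix.mul_assoc]
  have hG' : (1 + s * Q * s) * G = 1 := mul_eq_one_comm.1 hG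
  rw [multivariateGaussian, lintegral_map (by fun_prop) (by fun_prop), ← hs]
  have htw : (toLp 2 (G *ᵥ (c • (s *ᵥ x.ofLp))) : EuclideanSpace ℝ (Fin m)).ofLp
      + (s * Q * s) *ᵥ (toLp 2 (G *ᵥ (c • (s *ᵥ x.ofLp))) : EuclideanSpace ℝ (Fin m)).ofLp
      = (toLp 2 (c • (s *ᵥ x.ofLp)) : EuclideanSpace ℝ (Fin m)).ofLp := by
    simp only
    have : ((1 + s * Q * s) * G) *ᵥ (c • (s *ᵥ x.ofLp)) = c • (s *ᵥ x.ofLp) := by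
      rw [hG', one_mulVec]
    rwa [← mulVec_mulVec, add_mulVec, one_mulVec] at this
  have key := lintegral_exp_quadratic_stdGaussian hPs htw
  have hmove : ∀ a b : Fin m → ℝ, (s *ᵥ a) ⬝ᵥ b = a ⬝ᵥ s *ᵥ b := by
    intro a b
    rw [dotProduct_mulVec, ← mulVec_transpose, hsT]
  have hinner : ∀ a b : EuclideanSpace ℝ (Fin m), ⟪a, b⟫ = a.ofLp ⬝ᵥ b.ofLp := by
    intro a b
    simp [PiLp.inner_apply, dotProduct, mul_comm]
  convert key using 1
  · refine lintegral_congr fun v => ?_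
    simp only [zero_add, hinner, ofLp_toEuclideanCLM, hmove, smul_dotProduct, mulVec_mulVec,
      smul_eq_mul, Matrix.mul_assoc]
  · simp only [gaussianMass, hinner, smul_dotProduct, hmove, smul_mulVec, mulVec_smul,
      dotProduct_smul, smul_eq_mul, mulVec_mulVec, Matrix.mul_assoc]
    ring_nf

/-- The joint log-density of the optimal entropic coupling of two centered Gaussian measures. -/
noncomputable def gaussianLogDensity (ε : ℝ) (R Q : Matrix (Fin m) (Fin m) ℝ) (k : ℝ)
    (x y : EuclideanSpace ℝ (Fin m)) : ℝ :=
  2 / ε * ⟪x, y⟫ - (x.ofLp ⬝ᵥ R *ᵥ x.ofLp) / 2 - (y.ofLp ⬝ᵥ Q *ᵥ y.ofLp) / 2 + k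

/-- Existence of quadratic Schrödinger potentials between two centered Gaussian measures. -/
theorem exists_gaussian_potentials {ε : ℝ} (hε : 0 < ε) {A B : Matrix (Fin m) (Fin m) ℝ}
    (hA : A.PosSemidef) (hB : B.PosSemidef) :
    ∃ (R Q : Matrix (Fin m) (Fin m) ℝ) (k : ℝ), R.PosSemidef ∧ Q.PosSemidef ∧
      hsNorm R ≤ 4 / ε ^ 2 * hsNorm B ∧ hsNorm Q ≤ 4 / ε ^ 2 * hsNorm A ∧
      (∀ x, ∫⁻ y, ENNReal.ofReal (Real.exp (gaussianLogDensity ε R Q k x y))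
        ∂(multivariateGaussian 0 B) = 1) ∧
      (∀ y, ∫⁻ x, ENNReal.ofReal (Real.exp (gaussianLogDensity ε R Q k x y))
        ∂(multivariateGaussian 0 A) = 1) := by
  have hc : (0 : ℝ) < (2 / ε) ^ 2 := by positivity
  set p := CFC.sqrt A with hp
  set s := CFC.sqrt B with hs
  have hpT : pᵀ = p := isSymm_of_posSemidef (posSemidef_sqrt A)
  have hsT : sᵀ = s := isSymm_of_posSemidef (posSemidef_sqrt B)
  -- The factor `2 / ε` is the coefficient of `⟪x, y⟫` in `-‖x - y‖² / ε`, and it enters squared.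
  -- With `S = √A √B`, the system says that `G` and `H` invert `1 + √B Q √B` and `1 + √A R √A`.
  obtain ⟨G, H, hG, hH, hG1, hH1, hGH, hHG⟩ := exists_matrix_schrodinger (p * s) hc
  rw [transpose_mul, hpT, hsT] at hGH hHG
  set R := (2 / ε) ^ 2 • (s * G * s) with hR
  set Q := (2 / ε) ^ 2 • (p * H * p) with hQ
  have hconj : ∀ (s G : Matrix (Fin m) (Fin m) ℝ), sᵀ = s → G.PosSemidef →
      (s * G * s).PosSemidef := by
    intro s G hsT hG
    have := posSemidef_transpose_mul_mul hG s
    rwa [hsT] at this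
  have hRp : R.PosSemidef := (hconj s G hsT hG).smul hc.le
  have hQp : Q.PosSemidef := (hconj p H hpT hH).smul hc.le
  -- Conjugating `G ≤ 1` by `√B` gives the bound on `R`.
  have hRB : ((2 / ε) ^ 2 • B - R).PosSemidef := by
    have := (hconj s _ hsT hG1).smul hc.le
    convert this using 1
    rw [hR, ← smul_sub, ← sqrt_mul_sqrt hB, ← hs]
    congr 1
    noncomm_ring
  have hQA : ((2 / ε) ^ 2 • A - Q).PosSemidef := by
    have := (hconj p _ hpT hH1).smul hc.le
    convert this using 1
    rw [hQ, ← smul_sub, ← sqrt_mul_sqrt hA, ← hp]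
    congr 1
    noncomm_ring
  have hcc : (2 / ε) ^ 2 = 4 / ε ^ 2 := by ring
  have hGH' : G * (1 + s * Q * s) = 1 := by
    refine Eq.trans ?_ hGH
    rw [hQ]
    simp only [Matrix.mul_smul, Matrix.smul_mul, Matrix.mul_assoc]
  have hHG' : H * (1 + p * R * p) = 1 := by
    refine Eq.trans ?_ hHG
    rw [hR]
    simp only [Matrix.mul_smul, Matrix.smul_mul, Matrix.mul_assoc]
  have hmR := measurable_quadratic R
  have hmQ := measurable_quadratic Q
  have hB1 : ∀ k x, ∫⁻ y, ENNReal.ofReal (Real.exp (gaussianLogDensity ε R Q k x y))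
      ∂(multivariateGaussian 0 B) = ENNReal.ofReal (Real.exp k) * gaussianMass (s * Q * s) := by
    intro k x
    have h := lintegral_exp_quadratic_multivariateGaussian B (isSymm_of_posSemidef hQp) hGH'
      (2 / ε) x
    rw [← hs, ← hR] at h
    calc _ = ∫⁻ y, ENNReal.ofReal (Real.exp (k - (x.ofLp ⬝ᵥ R *ᵥ x.ofLp) / 2)) *
          ENNReal.ofReal (Real.exp (-(y.ofLp ⬝ᵥ Q *ᵥ y.ofLp) / 2 + 2 / ε * ⟪x, y⟫))
            ∂(multivariateGaussian 0 B) := by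
          refine lintegral_congr fun y => ?_
          rw [← ENNReal.ofReal_mul (Real.exp_pos _).le, ← Real.exp_add, gaussianLogDensity]
          congr 2
          ring
      _ = _ := by
          rw [lintegral_const_mul _ (by fun_prop), h, ← mul_assoc,
            ← ENNReal.ofReal_mul (Real.exp_pos _).le, ← Real.exp_add]
          congr 3
          ring
  have hA1 : ∀ k y, ∫⁻ x, ENNReal.ofReal (Real.exp (gaussianLogDensity ε R Q k x y))
      ∂(multivariateGaussian 0 A) = ENNReal.ofReal (Real.exp k) * gaussianMass (p * R * p) := by
    intro k y
    have h := lintegral_exp_quadratic_multivariateGaussian A (isSymm_of_posSemidef hRp) hHG'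
      (2 / ε) y
    rw [← hp, ← hQ] at h
    calc _ = ∫⁻ x, ENNReal.ofReal (Real.exp (k - (y.ofLp ⬝ᵥ Q *ᵥ y.ofLp) / 2)) *
          ENNReal.ofReal (Real.exp (-(x.ofLp ⬝ᵥ R *ᵥ x.ofLp) / 2 + 2 / ε * ⟪y, x⟫))
            ∂(multivariateGaussian 0 A) := by
          refine lintegral_congr fun x => ?_
          rw [← ENNReal.ofReal_mul (Real.exp_pos _).le, ← Real.exp_add, gaussianLogDensity,
            real_inner_comm]
          congr 2
          ring
      _ = _ := by
          rw [lintegral_const_mul _ (by fun_prop), h, ← mul_assoc,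
            ← ENNReal.ofReal_mul (Real.exp_pos _).le, ← Real.exp_add]
          congr 3
          ring
  -- By Tonelli, the two iterated integrals of the density with `k = 0` agree. Hence a single
  -- constant `k` normalizes both marginal equations.
  have hmass : gaussianMass (s * Q * s) = gaussianMass (p * R * p) := by
    have h := lintegral_lintegral_swap (μ := multivariateGaussian 0 A)
      (ν := multivariateGaussian 0 B)
      (f := fun x y => ENNReal.ofReal (Real.exp (gaussianLogDensity ε R Q 0 x y))) (by
        simp only [Function.uncurry_def, gaussianLogDensity]
        fun_prop)
    simpa [hA1, hB1] using h
  have h0 := gaussianMass_ne_zero (s * Q * s)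
  have ht := gaussianMass_ne_top (hconj s Q hsT hQp)
  have hone : ENNReal.ofReal (Real.exp (-Real.log (gaussianMass (s * Q * s)).toReal))
      * gaussianMass (s * Q * s) = 1 := by
    rw [Real.exp_neg, Real.exp_log (ENNReal.toReal_pos h0 ht),
      ENNReal.ofReal_inv_of_pos (ENNReal.toReal_pos h0 ht), ENNReal.ofReal_toReal ht,
      ENNReal.inv_mul_cancel h0 ht]
  refine ⟨R, Q, -Real.log (gaussianMass (s * Q * s)).toReal, hRp, hQp, ?_, ?_, ?_, ?_⟩
  · rw [← hcc]
    exact hsNorm_le_of_posSemidef_sub hc.le hRp hRB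
  · rw [← hcc]
    exact hsNorm_le_of_posSemidef_sub hc.le hQp hQA
  · exact fun x => (hB1 _ x).trans hone
  · exact fun y => (hA1 _ y).trans (hmass ▸ hone)

/-! ### Stability of the Gaussian entropic cost and of the Sinkhorn divergence. -/

/-- The entropic cost between two centered Gaussian measures, for the squared distance. -/
noncomputable def gaussianOT (ε : ℝ) (A B : Matrix (Fin m) (Fin m) ℝ) : ℝ :=
  (entropicOT (fun x y => edist x y ^ 2) ε (multivariateGaussian 0 A)
    (multivariateGaussian 0 B)).toReal

/-- The quadratic potential `x ↦ ‖x‖² - ε xᵀ R x / 2 + ε k`. -/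
noncomputable def quadPotential (ε : ℝ) (R : Matrix (Fin m) (Fin m) ℝ) (k : ℝ)
    (x : EuclideanSpace ℝ (Fin m)) : ℝ :=
  x.ofLp ⬝ᵥ (1 - (ε / 2) • R) *ᵥ x.ofLp + ε * k

theorem measurable_quadPotential (ε : ℝ) (R : Matrix (Fin m) (Fin m) ℝ) (k : ℝ) :
    Measurable (quadPotential ε R k) :=
  (measurable_quadratic _).add_const _

theorem integrable_quadPotential (ε : ℝ) (R : Matrix (Fin m) (Fin m) ℝ) (k : ℝ)
    (A : Matrix (Fin m) (Fin m) ℝ) :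
    Integrable (quadPotential ε R k) (multivariateGaussian 0 A) :=
  (integrable_quadratic_multivariateGaussian A _).add (integrable_const _)

theorem integral_quadPotential (ε : ℝ) (R : Matrix (Fin m) (Fin m) ℝ) (k : ℝ)
    {A : Matrix (Fin m) (Fin m) ℝ} (hA : A.PosSemidef) :
    ∫ x, quadPotential ε R k x ∂(multivariateGaussian 0 A)
      = A.trace - ε / 2 * (R * A).trace + ε * k := by
  simp only [quadPotential]
  rw [integral_add (integrable_quadratic_multivariateGaussian A _) (integrable_const _),
    integral_quadratic_multivariateGaussian hA, Matrix.sub_mul, trace_sub, Matrix.one_mul,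
    Matrix.smul_mul, trace_smul]
  simp

/-- The parts `‖x‖²` and `‖y‖²` of the potentials cancel those of `‖x - y‖²`, leaving the cross
term. The whole normalization `k` is put in the first potential. -/
theorem potentialLogDensity_quadPotential {ε : ℝ} (hε : 0 < ε) (R Q : Matrix (Fin m) (Fin m) ℝ)
    (k : ℝ) (x y : EuclideanSpace ℝ (Fin m)) :
    potentialLogDensity (fun x y : EuclideanSpace ℝ (Fin m) => ‖x - y‖ ^ 2) ε
      (quadPotential ε R k) (quadPotential ε Q 0) (x, y) = gaussianLogDensity ε R Q k x y := by
  simp only [potentialLogDensity, quadPotential, gaussianLogDensity, sub_mulVec, dotProduct_sub,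
    smul_mulVec, dotProduct_smul, ← norm_sq_eq_dotProduct, norm_sub_sq_real, smul_eq_mul]
  field_simp
  ring

theorem edist_sq_eq_ofReal (x y : EuclideanSpace ℝ (Fin m)) :
    edist x y ^ 2 = ENNReal.ofReal (‖x - y‖ ^ 2) := by
  rw [edist_dist, dist_eq_norm, ENNReal.ofReal_pow (norm_nonneg _)]

/-- Values and first order lower bounds for the entropic cost between Gaussian measures. -/
theorem exists_gaussianOT_subgradient {ε : ℝ} (hε : 0 < ε) {A B : Matrix (Fin m) (Fin m) ℝ}
    (hA : A.PosSemidef) (hB : B.PosSemidef) :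
    ∃ (R Q : Matrix (Fin m) (Fin m) ℝ), R.IsSymm ∧ Q.IsSymm ∧
      hsNorm R ≤ 4 / ε ^ 2 * hsNorm B ∧ hsNorm Q ≤ 4 / ε ^ 2 * hsNorm A ∧
      (∀ A' : Matrix (Fin m) (Fin m) ℝ, A'.PosSemidef →
        (A' - A).trace - ε / 2 * (R * (A' - A)).trace ≤ gaussianOT ε A' B - gaussianOT ε A B) ∧
      (∀ B' : Matrix (Fin m) (Fin m) ℝ, B'.PosSemidef →
        (B' - B).trace - ε / 2 * (Q * (B' - B)).trace
          ≤ gaussianOT ε A B' - gaussianOT ε A B) := by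
  obtain ⟨R, Q, k, hR, hQ, hRn, hQn, h1, h2⟩ := exists_gaussian_potentials hε hA hB
  have hd : Measurable (Function.uncurry fun x y : EuclideanSpace ℝ (Fin m) => ‖x - y‖ ^ 2) := by
    simp only [Function.uncurry_def]
    fun_prop
  have hd0 : ∀ x y : EuclideanSpace ℝ (Fin m), 0 ≤ ‖x - y‖ ^ 2 := fun x y => sq_nonneg _
  have hcost : (fun x y : EuclideanSpace ℝ (Fin m) => edist x y ^ 2)
      = fun x y => ENNReal.ofReal (‖x - y‖ ^ 2) := by
    funext x y
    exact edist_sq_eq_ofReal x y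
  have hfin := fun A B : Matrix (Fin m) (Fin m) ℝ => entropicOT_gaussian_ne_top ε 0 0 A B
  have ham := measurable_quadPotential ε R k
  have hbm := measurable_quadPotential ε Q 0
  have hai := integrable_quadPotential ε R k
  have hbi := integrable_quadPotential ε Q 0
  simp_rw [← potentialLogDensity_quadPotential hε] at h1 h2
  have hnorm : ∀ A : Matrix (Fin m) (Fin m) ℝ, Integrable
      (fun x : EuclideanSpace ℝ (Fin m) => 2 * ‖x‖ ^ 2) (multivariateGaussian 0 A) := by
    intro A
    simp_rw [norm_sq_eq_dotProduct]
    exact (integrable_quadratic_multivariateGaussian A 1).const_mul 2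
  have hval : gaussianOT ε A B = ∫ x, quadPotential ε R k x ∂(multivariateGaussian 0 A)
      + ∫ y, quadPotential ε Q 0 y ∂(multivariateGaussian 0 B) := by
    rw [gaussianOT, hcost]
    refine entropicOT_toReal_eq hε hd hd0 ham hbm (hai A) (hbi B) (hnorm A) (hnorm B) ?_ h1 h2
    intro x y
    have h := norm_sub_le x y
    nlinarith [norm_nonneg (x - y), sq_nonneg (‖x‖ - ‖y‖), norm_nonneg x, norm_nonneg y]
  rw [integral_quadPotential ε R k hA, integral_quadPotential ε Q 0 hB] at hval
  refine ⟨R, Q, isSymm_of_posSemidef hR, isSymm_of_posSemidef hQ, hRn, hQn, ?_, ?_⟩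
  · intro A' hA'
    -- Only the equation integrated over the second variable is used here, so the potentials for `A`
    -- are feasible for `A'`.
    have h := ofReal_add_integral_le_entropicOT hε hd hd0 ham hbm (hai A') (hbi B)
      (lintegral_exp_potentialLogDensity hd ham hbm h1)
    rw [← hcost, ENNReal.ofReal_le_iff_le_toReal (hfin A' B), integral_quadPotential ε R k hA',
      integral_quadPotential ε Q 0 hB] at h
    rw [hval, Matrix.mul_sub, trace_sub, trace_sub]
    unfold gaussianOT
    linarith
  · intro B' hB'
    have h := ofReal_add_integral_le_entropicOT hε hd hd0 ham hbm (hai A) (hbi B')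
      (lintegral_exp_potentialLogDensity' hd ham hbm h2)
    rw [← hcost, ENNReal.ofReal_le_iff_le_toReal (hfin A B'), integral_quadPotential ε R k hA,
      integral_quadPotential ε Q 0 hB'] at h
    rw [hval, Matrix.mul_sub, trace_sub, trace_sub]
    unfold gaussianOT
    linarith

theorem mul_trace_mul_le {ε : ℝ} (hε : 0 < ε) {R B D : Matrix (Fin m) (Fin m) ℝ}
    (hR : R.IsSymm) (hRB : hsNorm R ≤ 4 / ε ^ 2 * hsNorm B) :
    |ε / 2 * (R * D).trace| ≤ 2 / ε * hsNorm B * hsNorm D := by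
  rw [abs_mul, abs_of_pos (by positivity : 0 < ε / 2)]
  calc ε / 2 * |(R * D).trace| ≤ ε / 2 * (4 / ε ^ 2 * hsNorm B * hsNorm D) := by
        gcongr
        exact (abs_trace_mul_le hR D).trans (by gcongr; exact hsNorm_nonneg D)
    _ = 2 / ε * hsNorm B * hsNorm D := by
        field_simp
        ring

/-- Lipschitz estimate for the entropic cost in the first covariance matrix. -/
theorem abs_gaussianOT_sub_left_le {ε : ℝ} (hε : 0 < ε) {A A' B : Matrix (Fin m) (Fin m) ℝ}
    (hA : A.PosSemidef) (hA' : A'.PosSemidef) (hB : B.PosSemidef) :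
    |gaussianOT ε A' B - gaussianOT ε A B - (A'.trace - A.trace)|
      ≤ 2 / ε * hsNorm B * hsNorm (A' - A) := by
  obtain ⟨R, _, hR, _, hRB, _, h, _⟩ := exists_gaussianOT_subgradient hε hA hB
  obtain ⟨R', _, hR', _, hRB', _, h', _⟩ := exists_gaussianOT_subgradient hε hA' hB
  -- The inequality based at `A` gives the lower bound, and the one based at `A'` the upper bound.
  have e := h A' hA'
  have e' := h' A hA
  have b := abs_le.1 (mul_trace_mul_le hε hR hRB (D := A' - A))
  have b' := abs_le.1 (mul_trace_mul_le hε hR' hRB' (D := A - A'))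
  rw [hsNorm_sub_comm] at b'
  rw [trace_sub] at e e'
  exact abs_le.2 ⟨by linarith [b.2], by linarith [b'.2]⟩

/-- Lipschitz estimate for the entropic cost in the second covariance matrix. -/
theorem abs_gaussianOT_sub_right_le {ε : ℝ} (hε : 0 < ε) {A B B' : Matrix (Fin m) (Fin m) ℝ}
    (hA : A.PosSemidef) (hB : B.PosSemidef) (hB' : B'.PosSemidef) :
    |gaussianOT ε A B' - gaussianOT ε A B - (B'.trace - B.trace)|
      ≤ 2 / ε * hsNorm A * hsNorm (B' - B) := by
  obtain ⟨_, Q, _, hQ, _, hQA, _, h⟩ := exists_gaussianOT_subgradient hε hA hB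
  obtain ⟨_, Q', _, hQ', _, hQA', _, h'⟩ := exists_gaussianOT_subgradient hε hA hB'
  have e := h B' hB'
  have e' := h' B hB
  have b := abs_le.1 (mul_trace_mul_le hε hQ hQA (D := B' - B))
  have b' := abs_le.1 (mul_trace_mul_le hε hQ' hQA' (D := B - B'))
  rw [hsNorm_sub_comm] at b'
  rw [trace_sub] at e e'
  exact abs_le.2 ⟨by linarith [b.2], by linarith [b'.2]⟩

/-- Stability of the Sinkhorn divergence between centered Gaussian measures. -/
theorem abs_sinkhornDiv_sub_le {ε : ℝ} (hε : 0 < ε) {A A' B B' : Matrix (Fin m) (Fin m) ℝ}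
    (hA : A.PosSemidef) (hA' : A'.PosSemidef) (hB : B.PosSemidef) (hB' : B'.PosSemidef)
    {α β : ℝ} (hα : hsNorm A ≤ α) (hβ : hsNorm B ≤ β) :
    |sinkhornDiv ε (multivariateGaussian 0 A') (multivariateGaussian 0 B')
        - sinkhornDiv ε (multivariateGaussian 0 A) (multivariateGaussian 0 B)|
      ≤ 2 / ε * ((α + β) * (hsNorm (A' - A) + hsNorm (B' - B))
          + (hsNorm (A' - A) + hsNorm (B' - B)) ^ 2 / 2) := by
  set p := hsNorm (A' - A) with hp
  set q := hsNorm (B' - B) with hq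
  have hp0 : 0 ≤ p := hsNorm_nonneg _
  have hq0 : 0 ≤ q := hsNorm_nonneg _
  have hA'n : hsNorm A' ≤ α + p := (hsNorm_le_add_sub A' A).trans (by linarith)
  have hB'n : hsNorm B' ≤ β + q := (hsNorm_le_add_sub B' B).trans (by linarith)
  have bound : ∀ {x y z : ℝ}, 0 ≤ z → x ≤ y → 2 / ε * x * z ≤ 2 / ε * y * z := by
    intro x y z hz hxy
    gcongr
  -- Each of the three costs changes one argument at a time: `(A, B)` to `(A', B')` through `(A',
  -- B)`, and likewise for the two self-costs. The six trace differences cancel in the final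
  -- combination.
  have t1 := abs_le.1 ((abs_gaussianOT_sub_left_le hε hA hA' hB).trans (bound hp0 hβ))
  have t2 := abs_le.1 ((abs_gaussianOT_sub_right_le hε hA' hB hB').trans (bound hq0 hA'n))
  have t3 := abs_le.1 ((abs_gaussianOT_sub_left_le hε hA hA' hA).trans (bound hp0 hα))
  have t4 := abs_le.1 ((abs_gaussianOT_sub_right_le hε hA' hA hA').trans (bound hp0 hA'n))
  have t5 := abs_le.1 ((abs_gaussianOT_sub_left_le hε hB hB' hB).trans (bound hq0 hβ))
  have t6 := abs_le.1 ((abs_gaussianOT_sub_right_le hε hB' hB hB').trans (bound hq0 hB'n))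
  change |gaussianOT ε A' B' - 1 / 2 * (gaussianOT ε A' A' + gaussianOT ε B' B')
    - (gaussianOT ε A B - 1 / 2 * (gaussianOT ε A A + gaussianOT ε B B))| ≤ _
  have expand : 2 / ε * ((α + β) * (p + q) + (p + q) ^ 2 / 2)
      = 2 / ε * β * p + 2 / ε * (α + p) * q + (2 / ε * α * p + 2 / ε * (α + p) * p) / 2
        + (2 / ε * β * q + 2 / ε * (β + q) * q) / 2 := by ring
  rw [expand]
  exact abs_le.2 ⟨by linarith [t1.1, t2.1, t3.2, t4.2, t5.2, t6.2],
    by linarith [t1.2, t2.2, t3.1, t4.1, t5.1, t6.1]⟩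

end GaussianPotentials

/-! ### Second and fourth moments of a centered Gaussian process. -/

section Moments

open scoped NNReal

/-- The fourth moment is the fourth derivative at zero of `exp (v t² / 2)`. Each differentiation
keeps the exponential and replaces the factor `f` by `v t f + f'`. -/
theorem integral_pow_four_gaussianReal (v : ℝ≥0) :
    ∫ x, x ^ 4 ∂(gaussianReal 0 v) = 3 * (v : ℝ) ^ 2 := by
  have h := iteratedDeriv_mgf_zero (X := id) (μ := gaussianReal 0 v)
    (by rw [integrableExpSet_id_gaussianReal]; simp) 4
  have e : mgf id (gaussianReal 0 v) = fun t => Real.exp (v * t ^ 2 / 2) := by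
    rw [mgf_id_gaussianReal]
    simp
  have d0 : ∀ t : ℝ, HasDerivAt (fun t : ℝ => Real.exp (v * t ^ 2 / 2))
      (Real.exp (v * t ^ 2 / 2) * (v * t)) t := by
    intro t
    have h1 : HasDerivAt (fun t : ℝ => (v : ℝ) * t ^ 2 / 2) (v * t) t := by
      refine (((hasDerivAt_pow 2 t).const_mul (v : ℝ)).div_const 2).congr_deriv ?_
      norm_num
      ring
    exact h1.exp
  have step : ∀ (f f' : ℝ → ℝ), (∀ t, HasDerivAt f (f' t) t) →
      deriv (fun t => Real.exp (v * t ^ 2 / 2) * f t)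
        = fun t => Real.exp (v * t ^ 2 / 2) * (v * t * f t + f' t) := by
    intro f f' hf
    funext t
    exact (((d0 t).mul (hf t)).congr_deriv (by ring)).deriv
  have e1 : deriv (fun t : ℝ => Real.exp (v * t ^ 2 / 2))
      = fun t => Real.exp (v * t ^ 2 / 2) * (v * t) := by
    funext t
    exact (d0 t).deriv
  have e2 := step (fun t => v * t) (fun _ => v) fun t => by
    simpa using (hasDerivAt_id t).const_mul (v : ℝ)
  have e3 := step (fun t => v * t * (v * t) + v) (fun t => 2 * v ^ 2 * t) fun t => by
    have h1 := (hasDerivAt_id t).const_mul (v : ℝ)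
    refine ((h1.mul h1).add_const (v : ℝ)).congr_deriv ?_
    simp
    ring
  have e4 := step (fun t => v * t * (v * t * (v * t) + v) + 2 * v ^ 2 * t)
    (fun t => 3 * v ^ 3 * t ^ 2 + 3 * v ^ 2) fun t => by
    have h1 := (hasDerivAt_id t).const_mul (v : ℝ)
    refine ((h1.mul ((h1.mul h1).add_const (v : ℝ))).add
      ((hasDerivAt_id t).const_mul (2 * (v : ℝ) ^ 2))).congr_deriv ?_
    simp
    ring
  rw [e, iteratedDeriv_succ, iteratedDeriv_succ, iteratedDeriv_succ, iteratedDeriv_one, e1, e2, e3,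
    e4] at h
  simpa using h.symm

variable {T Ω : Type*} [MeasurableSpace Ω] {ξ : T → Ω → ℝ} {K : T → T → ℝ} {P : Measure Ω}

theorem IsCenteredGP.integral_mul (hξ : IsCenteredGP ξ K P) (s t : T) :
    ∫ ω, ξ s ω * ξ t ω ∂P = K s t := by
  simpa [hξ.mean] using hξ.cov s t

theorem IsCenteredGP.memLp (hξ : IsCenteredGP ξ K P) (t : T) {p : ℝ≥0∞} (hp : p ≠ ⊤) :
    MemLp (ξ t) p P :=
  (hξ.gaussian.hasGaussianLaw_eval t).memLp hp

theorem IsCenteredGP.memLp_mul (hξ : IsCenteredGP ξ K P) (s t : T) :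
    MemLp (fun ω => ξ s ω * ξ t ω) 2 P := by
  have : ENNReal.HolderTriple 4 4 2 := by
    constructor
    rw [← two_mul, show (4 : ℝ≥0∞) = 2 * 2 by norm_num,
      ENNReal.mul_inv (by simp) (by simp), ← mul_assoc,
      ENNReal.mul_inv_cancel (by simp) (by simp), one_mul]
  exact (hξ.memLp t (by simp : (4 : ℝ≥0∞) ≠ ⊤)).mul (hξ.memLp s (by simp : (4 : ℝ≥0∞) ≠ ⊤))

theorem IsCenteredGP.integral_pow_four (hξ : IsCenteredGP ξ K P) (t : T) :
    ∫ ω, ξ t ω ^ 4 ∂P = 3 * K t t ^ 2 := by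
  have : IsProbabilityMeasure P := hξ.gaussian.isProbabilityMeasure
  have hlaw := (hξ.gaussian.hasGaussianLaw_eval t).map_eq_gaussianReal
  have hae := hξ.gaussian.aemeasurable t
  have hv : Var[ξ t; P] = K t t := by
    rw [← covariance_self hae]
    exact hξ.cov t t
  rw [hξ.mean, hv] at hlaw
  have h0 : 0 ≤ K t t := by rw [← hv]; exact variance_nonneg _ _
  have h := integral_map hae (f := fun x : ℝ => x ^ 4) (by fun_prop)
  rw [← h, hlaw, integral_pow_four_gaussianReal, Real.coe_toNNReal _ h0]

theorem IsCenteredGP.integrable_pow_four (hξ : IsCenteredGP ξ K P) (t : T) :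
    Integrable (fun ω => ξ t ω ^ 4) P := by
  have := (hξ.memLp_mul t t).integrable_sq
  refine this.congr (Filter.Eventually.of_forall fun ω => ?_)
  simp only
  ring

/-- The variance of a product of two values of a centered Gaussian process. -/
theorem IsCenteredGP.variance_mul_le (hξ : IsCenteredGP ξ K P) {κ : ℝ}
    (hK : ∀ t, K t t ≤ κ ^ 2) (s t : T) :
    Var[fun ω => ξ s ω * ξ t ω; P] ≤ 3 * κ ^ 4 := by
  have : IsProbabilityMeasure P := hξ.gaussian.isProbabilityMeasure
  have h4 : ∀ t, ∫ ω, ξ t ω ^ 4 ∂P ≤ 3 * κ ^ 4 := by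
    intro t
    have h0 : 0 ≤ K t t := by
      rw [← hξ.integral_mul]
      exact integral_nonneg fun ω => mul_self_nonneg _
    rw [hξ.integral_pow_four]
    nlinarith [hK t]
  calc Var[fun ω => ξ s ω * ξ t ω; P] ≤ ∫ ω, (ξ s ω * ξ t ω) ^ 2 ∂P :=
        variance_le_expectation_sq (hξ.memLp_mul s t).aestronglyMeasurable
    _ ≤ ∫ ω, (ξ s ω ^ 4 + ξ t ω ^ 4) / 2 ∂P := by
        refine integral_mono (hξ.memLp_mul s t).integrable_sq
          (((hξ.integrable_pow_four s).add (hξ.integrable_pow_four t)).div_const 2) fun ω => ?_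
        simp only
        -- The arithmetic–geometric mean inequality replaces the exact mixed moment, so only
        -- one-dimensional fourth moments are needed.
        nlinarith [sq_nonneg (ξ s ω ^ 2 - ξ t ω ^ 2)]
    _ ≤ 3 * κ ^ 4 := by
        rw [integral_div, integral_add (hξ.integrable_pow_four s) (hξ.integrable_pow_four t)]
        linarith [h4 s, h4 t]

end Moments

/-! ### Mean-square error of the empirical covariance matrix. -/

section EmpiricalCovariance

open Matrix

variable {T Ω : Type*} {K : T → T → ℝ} {m N : ℕ}

/-- The coefficients `(1, 1)` and `(1, -1)` give `K s s + K t t ± 2 K s t ≥ 0`. -/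
theorem IsPosDefKernel.abs_le (hK : IsPosDefKernel K) {κ : ℝ} (hb : ∀ t, K t t ≤ κ ^ 2)
    (s t : T) : |K s t| ≤ κ ^ 2 := by
  have h1 := hK.2 2 ![s, t] ![1, 1]
  have h2 := hK.2 2 ![s, t] ![1, -1]
  simp [Fin.sum_univ_two, hK.1 t s] at h1 h2
  exact _root_.abs_le.2 ⟨by linarith [hb s, hb t], by linarith [hb s, hb t]⟩

theorem IsPosDefKernel.posSemidef_gram (hK : IsPosDefKernel K) (X : Fin m → T) :
    (gram K X).PosSemidef := by
  refine PosSemidef.of_dotProduct_mulVec_nonneg ?_ fun a => ?_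
  · ext i j
    simp [gram, hK.1 (X j)]
  · have := hK.2 m X a
    simpa [dotProduct, mulVec, gram, Finset.mul_sum, mul_assoc, mul_comm, mul_left_comm] using this

/-- The `m²` entries are each at most `κ² / m` in absolute value, so the bound does not depend on
`m`. -/
theorem hsNorm_gram_le (hK : IsPosDefKernel K) {κ : ℝ} (hb : ∀ t, K t t ≤ κ ^ 2) (hm : 0 < m)
    (X : Fin m → T) : hsNorm ((1 / (m : ℝ)) • gram K X) ≤ κ ^ 2 := by
  have hm' : (0 : ℝ) < m := by exact_mod_cast hm
  refine (abs_le_of_sq_le_sq' ?_ (sq_nonneg κ)).2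
  rw [hsNorm_sq]
  calc ∑ i, ∑ j, ((1 / (m : ℝ)) • gram K X) i j ^ 2
      ≤ ∑ _i : Fin m, ∑ _j : Fin m, (1 / (m : ℝ)) ^ 2 * (κ ^ 2) ^ 2 := by
        refine Finset.sum_le_sum fun i _ => Finset.sum_le_sum fun j _ => ?_
        simp only [gram, Matrix.smul_apply, of_apply, smul_eq_mul, mul_pow]
        refine mul_le_mul_of_nonneg_left ?_ (by positivity)
        rw [← sq_abs]
        exact pow_le_pow_left₀ (abs_nonneg _) (hK.abs_le hb _ _) 2
    _ = (κ ^ 2) ^ 2 := by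
        simp
        field_simp

theorem posSemidef_empCov (ξ : T → Ω → ℝ) (X : Fin m → T) (W : Fin N → Ω) :
    (empCov ξ X W).PosSemidef := by
  have := posSemidef_self_mul_conjTranspose (dataMatrix ξ X W)
  rw [conjTranspose_eq_transpose_of_trivial] at this
  exact this.smul (by positivity)

theorem empCov_apply (ξ : T → Ω → ℝ) (X : Fin m → T) (W : Fin N → Ω) (j k : Fin m) :
    empCov ξ X W j k = (1 / (N : ℝ)) * ∑ l, ξ (X j) (W l) * ξ (X k) (W l) := by
  simp [empCov, Matrix.mul_apply, dataMatrix]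

/-- Hilbert–Schmidt error of the normalized empirical covariance matrix. -/
noncomputable def empError (ξ : T → Ω → ℝ) (K : T → T → ℝ) (X : Fin m → T) (W : Fin N → Ω) : ℝ :=
  hsNorm ((1 / (m : ℝ)) • empCov ξ X W - (1 / (m : ℝ)) • gram K X)

theorem empError_sq (ξ : T → Ω → ℝ) (K : T → T → ℝ) (X : Fin m → T) (W : Fin N → Ω) :
    empError ξ K X W ^ 2
      = ∑ j, ∑ k, (1 / (m : ℝ)) ^ 2 * (empCov ξ X W j k - gram K X j k) ^ 2 := by
  simp only [empError, hsNorm_sq, ← smul_sub, Matrix.smul_apply, Matrix.sub_apply, smul_eq_mul,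
    mul_pow]

variable [MeasurableSpace Ω] {ξ : T → Ω → ℝ} {P : Measure Ω}

theorem memLp_empCov [IsProbabilityMeasure P] (hξ : IsCenteredGP ξ K P) (X : Fin m → T)
    (j k : Fin m) :
    MemLp (fun W : Fin N → Ω => empCov ξ X W j k) 2 (Measure.pi fun _ => P) := by
  simp_rw [empCov_apply]
  have h : ∀ l : Fin N, MemLp (fun W : Fin N → Ω => ξ (X j) (W l) * ξ (X k) (W l)) 2
      (Measure.pi fun _ => P) := fun l =>
    (hξ.memLp_mul (X j) (X k)).comp_measurePreserving (measurePreserving_eval (fun _ => P) l)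
  exact (memLp_finsetSum Finset.univ fun l _ => h l).const_mul _

theorem integral_empCov [IsProbabilityMeasure P] (hξ : IsCenteredGP ξ K P) (hN : 0 < N)
    (X : Fin m → T) (j k : Fin m) :
    ∫ W : Fin N → Ω, empCov ξ X W j k ∂(Measure.pi fun _ => P) = gram K X j k := by
  have hN' : (N : ℝ) ≠ 0 := by exact_mod_cast hN.ne'
  have hi := (hξ.memLp_mul (X j) (X k)).integrable (by norm_num)
  simp_rw [empCov_apply]
  have hil : ∀ l : Fin N, Integrable (fun W : Fin N → Ω => ξ (X j) (W l) * ξ (X k) (W l))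
      (Measure.pi fun _ => P) := fun l =>
    (measurePreserving_eval (fun _ => P) l).integrable_comp_of_integrable hi
  rw [integral_const_mul, integral_finsetSum _ fun l _ => hil l]
  have : ∀ l : Fin N, ∫ W : Fin N → Ω, ξ (X j) (W l) * ξ (X k) (W l) ∂(Measure.pi fun _ => P)
      = gram K X j k := by
    intro l
    have h := integral_comp_eval (μ := fun _ : Fin N => P) (i := l)
      (f := fun ω => ξ (X j) ω * ξ (X k) ω) hi.aestronglyMeasurable
    rw [h, hξ.integral_mul]
    rfl
  simp only [this]
  simp [hN']

/-- The estimator is unbiased, so this is its variance; averaging `N` independent copies divides the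
variance of one product by `N`. -/
theorem integral_sq_empCov_sub_le [IsProbabilityMeasure P] (hξ : IsCenteredGP ξ K P) {κ : ℝ}
    (hb : ∀ t, K t t ≤ κ ^ 2) (hN : 0 < N) (X : Fin m → T) (j k : Fin m) :
    ∫ W : Fin N → Ω, (empCov ξ X W j k - gram K X j k) ^ 2 ∂(Measure.pi fun _ => P)
      ≤ 3 * κ ^ 4 / N := by
  have hN' : (0 : ℝ) < N := by exact_mod_cast hN
  have hvar := variance_eq_integral (memLp_empCov (N := N) hξ X j k).aemeasurable
  rw [integral_empCov hξ hN] at hvar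
  rw [← hvar]
  simp_rw [empCov_apply]
  rw [variance_const_mul]
  have hs := variance_sum_pi (μ := fun _ : Fin N => P)
    (X := fun _ ω => ξ (X j) ω * ξ (X k) ω) fun _ => hξ.memLp_mul (X j) (X k)
  have he : (fun W : Fin N → Ω => ∑ l, ξ (X j) (W l) * ξ (X k) (W l))
      = ∑ l, fun W : Fin N → Ω => ξ (X j) (W l) * ξ (X k) (W l) := by
    ext W
    simp
  rw [he, hs]
  simp only [Finset.sum_const, Finset.card_univ, Fintype.card_fin, nsmul_eq_mul]
  calc (1 / (N : ℝ)) ^ 2 * (N * Var[fun ω => ξ (X j) ω * ξ (X k) ω; P])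
      ≤ (1 / (N : ℝ)) ^ 2 * (N * (3 * κ ^ 4)) := by
        gcongr
        exact hξ.variance_mul_le hb _ _
    _ = 3 * κ ^ 4 / N := by
        field_simp

theorem integrable_empError_sq [IsProbabilityMeasure P] (hξ : IsCenteredGP ξ K P)
    (X : Fin m → T) :
    Integrable (fun W : Fin N → Ω => empError ξ K X W ^ 2) (Measure.pi fun _ => P) := by
  simp_rw [empError_sq]
  exact integrable_finsetSum _ fun j _ => integrable_finsetSum _ fun k _ =>
    ((memLp_empCov hξ X j k).sub (memLp_const _)).integrable_sq.const_mul _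

theorem integral_empError_sq_le [IsProbabilityMeasure P] (hξ : IsCenteredGP ξ K P) {κ : ℝ}
    (hb : ∀ t, K t t ≤ κ ^ 2) (hm : 0 < m) (hN : 0 < N) (X : Fin m → T) :
    ∫ W : Fin N → Ω, empError ξ K X W ^ 2 ∂(Measure.pi fun _ => P) ≤ 3 * κ ^ 4 / N := by
  have hm' : (0 : ℝ) < m := by exact_mod_cast hm
  have hi : ∀ j k, Integrable (fun W : Fin N → Ω =>
      (1 / (m : ℝ)) ^ 2 * (empCov ξ X W j k - gram K X j k) ^ 2) (Measure.pi fun _ => P) :=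
    fun j k => ((memLp_empCov hξ X j k).sub (memLp_const _)).integrable_sq.const_mul _
  simp_rw [empError_sq]
  rw [integral_finsetSum _ fun j _ => integrable_finsetSum _ fun k _ => hi j k]
  calc _ ≤ ∑ _j : Fin m, ∑ _k : Fin m, (1 / (m : ℝ)) ^ 2 * (3 * κ ^ 4 / N) := by
        refine Finset.sum_le_sum fun j _ => ?_
        rw [integral_finsetSum _ fun k _ => hi j k]
        refine Finset.sum_le_sum fun k _ => ?_
        rw [integral_const_mul]
        exact mul_le_mul_of_nonneg_left (integral_sq_empCov_sub_le hξ hb hN X j k) (by positivity)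
    _ = 3 * κ ^ 4 / N := by
        simp
        field_simp

end EmpiricalCovariance

/-! ### Markov's inequality and comparison of constants. -/

section Concentration

/-- Markov's inequality, for the probability of an event implied by a moment bound. -/
theorem ofReal_one_sub_le_measure {Ω : Type*} [MeasurableSpace Ω] {P : Measure Ω}
    [IsProbabilityMeasure P] {u : Ω → ℝ} (hu : Integrable u P) (hu0 : ∀ ω, 0 ≤ u ω) {M δ : ℝ}
    (hM : 0 < M) (hδ : 0 < δ) (huM : ∫ ω, u ω ∂P ≤ M) {s : Set Ω}
    (hs : ∀ ω, u ω ≤ M / δ → ω ∈ s) : ENNReal.ofReal (1 - δ) ≤ P s := by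
  have hMδ : 0 < M / δ := by positivity
  have h1 := (mul_meas_ge_le_integral_of_nonneg (Filter.Eventually.of_forall hu0) hu
    (M / δ)).trans huM
  have h2 : P.real {ω | M / δ ≤ u ω} ≤ δ := by
    rw [← le_div_iff₀' hMδ] at h1
    rwa [div_div_cancel₀ hM.ne'] at h1
  have h3 : P sᶜ ≤ ENNReal.ofReal δ := by
    refine (measure_mono (t := {ω | M / δ ≤ u ω}) fun ω hω => ?_).trans ?_
    · by_contra h
      exact hω (hs ω (not_le.1 h).le)
    · rw [← ENNReal.ofReal_toReal (measure_ne_top P {ω | M / δ ≤ u ω})]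
      exact ENNReal.ofReal_le_ofReal h2
  rw [ENNReal.ofReal_sub _ hδ.le, ENNReal.ofReal_one, tsub_le_iff_right]
  -- Subadditivity suffices, so `s` need not be measurable.
  calc 1 = P (s ∪ sᶜ) := by rw [Set.union_compl_self, measure_univ]
    _ ≤ P s + P sᶜ := measure_union_le _ _
    _ ≤ P s + ENNReal.ofReal δ := by gcongr

/-- Used with `α = κ₁²` and `β = κ₂²`: when the second moments of `p` and `q` are proportional to
`α²` and `β²`, the right side has mean proportional to `(α + β)²`. -/
theorem sq_add_le_weighted {α β : ℝ} (hα : 0 < α) (hβ : 0 < β) (p q : ℝ) :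
    (p + q) ^ 2 ≤ (1 + β / α) * p ^ 2 + (1 + α / β) * q ^ 2 := by
  have h : (1 + β / α) * p ^ 2 + (1 + α / β) * q ^ 2 - (p + q) ^ 2
      = (β * p - α * q) ^ 2 / (α * β) := by
    field_simp
    ring
  have : 0 ≤ (β * p - α * q) ^ 2 / (α * β) := by positivity
  linarith

/-- Comparison of the deterministic stability bound with the bound of the theorem. -/
theorem stability_bound_le {κ₁ κ₂ ε δ n r : ℝ} (hε : 0 < ε) (hδ₀ : 0 < δ) (hδ₁ : δ < 1)
    (hn0 : 0 < n) (hn1 : n ≤ 1)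
    (hr : r ^ 2 ≤ 3 * (κ₁ ^ 2 + κ₂ ^ 2) ^ 2 * n ^ 2 / δ) :
    2 / ε * ((κ₁ ^ 2 + κ₂ ^ 2) * r + r ^ 2 / 2) ≤ 12 * √3 / (ε * δ) *
      ((1 + 4 / δ) * κ₁ ^ 4 + (3 + 8 / δ) * κ₁ ^ 2 * κ₂ ^ 2 + κ₂ ^ 4) * n := by
  set g := κ₁ ^ 2 + κ₂ ^ 2 with hg
  have hg0 : 0 ≤ g := by positivity
  have h3 : √3 ^ 2 = 3 := Real.sq_sqrt (by norm_num)
  have h3' : (3 : ℝ) / 2 ≤ √3 := Real.le_sqrt_of_sq_le (by norm_num)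
  have hr1 : r ≤ √3 * g * n / δ := by
    refine (abs_le_of_sq_le_sq' (hr.trans ?_) (by positivity)).2
    rw [div_pow, mul_pow, mul_pow, h3]
    -- Here `δ² ≤ δ` trades the natural `1 / √δ` for the `1 / δ` of the stated bound.
    refine div_le_div_of_nonneg_left (by positivity) (by positivity) ?_
    nlinarith
  have hr2 : r ^ 2 / 2 ≤ √3 * g ^ 2 * n / δ := by
    calc r ^ 2 / 2 ≤ 3 * g ^ 2 * n ^ 2 / δ / 2 := by gcongr
      _ = (3 / 2) * g ^ 2 * (n * n) / δ := by ring
      -- The quadratic error is absorbed into the linear one through `n ≤ 1` and `3 / 2 ≤ √3`.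
      _ ≤ √3 * g ^ 2 * (n * 1) / δ := by gcongr
      _ = √3 * g ^ 2 * n / δ := by ring
  have hC : g ^ 2 ≤ (1 + 4 / δ) * κ₁ ^ 4 + (3 + 8 / δ) * κ₁ ^ 2 * κ₂ ^ 2 + κ₂ ^ 4 := by
    have h1 : 0 ≤ 4 / δ * κ₁ ^ 4 := by positivity
    have h2 : 0 ≤ (1 + 8 / δ) * (κ₁ ^ 2 * κ₂ ^ 2) := by positivity
    rw [hg]
    nlinarith
  calc 2 / ε * (g * r + r ^ 2 / 2)
      ≤ 2 / ε * (g * (√3 * g * n / δ) + √3 * g ^ 2 * n / δ) := by gcongr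
    _ = 4 * √3 / (ε * δ) * g ^ 2 * n := by
        field_simp
        ring
    _ ≤ 12 * √3 / (ε * δ) *
      ((1 + 4 / δ) * κ₁ ^ 4 + (3 + 8 / δ) * κ₁ ^ 2 * κ₂ ^ 2 + κ₂ ^ 4) * n := by
        gcongr
        norm_num

end Concentration

end SinkhornGP

/-! ### Conclusion: stability on the Markov event. -/

theorem mainTheorem4
    {T : Type*} [MetricSpace T] [SigmaCompactSpace T] [MeasurableSpace T] [BorelSpace T]
    (ν : Measure T) [IsProbabilityMeasure ν] [ν.IsOpenPosMeasure]
    (K₁ K₂ : T → T → ℝ)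
    (hK₁c : Continuous (Function.uncurry K₁)) (hK₂c : Continuous (Function.uncurry K₂))
    (hK₁ : SinkhornGP.IsPosDefKernel K₁) (hK₂ : SinkhornGP.IsPosDefKernel K₂)
    (κ₁ κ₂ : ℝ) (hκ₁ : 0 < κ₁) (hκ₂ : 0 < κ₂)
    (hK₁b : ∀ t, K₁ t t ≤ κ₁ ^ 2) (hK₂b : ∀ t, K₂ t t ≤ κ₂ ^ 2)
    {Ω₁ Ω₂ : Type*} [MeasurableSpace Ω₁] [MeasurableSpace Ω₂]
    (P₁ : Measure Ω₁) [IsProbabilityMeasure P₁] (P₂ : Measure Ω₂) [IsProbabilityMeasure P₂]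
    (ξ₁ : T → Ω₁ → ℝ) (ξ₂ : T → Ω₂ → ℝ)
    (hξ₁ : SinkhornGP.IsCenteredGP ξ₁ K₁ P₁) (hξ₂ : SinkhornGP.IsCenteredGP ξ₂ K₂ P₂)
    (ε : ℝ) (hε : 0 < ε)
    (m N : ℕ) (hm : 0 < m) (hN : 0 < N) (X : Fin m → T)
    (δ : ℝ) (hδ₀ : 0 < δ) (hδ₁ : δ < 1) :
    ENNReal.ofReal (1 - δ) ≤
      ((Measure.pi fun _ : Fin N => P₁).prod (Measure.pi fun _ : Fin N => P₂))
        {W : (Fin N → Ω₁) × (Fin N → Ω₂) |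
          |SinkhornGP.sinkhornDiv ε
              (multivariateGaussian 0 ((1 / (m : ℝ)) • SinkhornGP.empCov ξ₁ X W.1))
              (multivariateGaussian 0 ((1 / (m : ℝ)) • SinkhornGP.empCov ξ₂ X W.2))
            - SinkhornGP.sinkhornDiv ε
              (multivariateGaussian 0 ((1 / (m : ℝ)) • SinkhornGP.gram K₁ X))
              (multivariateGaussian 0 ((1 / (m : ℝ)) • SinkhornGP.gram K₂ X))|
          ≤ 12 * √3 / (ε * δ) *
              ((1 + 4 / δ) * κ₁ ^ 4 + (3 + 8 / δ) * κ₁ ^ 2 * κ₂ ^ 2 + κ₂ ^ 4) *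
              (1 / √(N : ℝ))} := by
  open SinkhornGP in
  have hN' : (0 : ℝ) < N := by exact_mod_cast hN
  have hκ₁2 : 0 < κ₁ ^ 2 := by positivity
  have hκ₂2 : 0 < κ₂ ^ 2 := by positivity
  have hm0 : (0 : ℝ) ≤ 1 / (m : ℝ) := by positivity
  set g := κ₁ ^ 2 + κ₂ ^ 2 with hg
  have hi₁ := (integrable_empError_sq (N := N) hξ₁ X).comp_fst (Measure.pi fun _ : Fin N => P₂)
  have hi₂ := (integrable_empError_sq (N := N) hξ₂ X).comp_snd (Measure.pi fun _ : Fin N => P₁)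
  -- The weights are chosen so that the means `3 κ₁⁴ / N` and `3 κ₂⁴ / N` add up to `3 (κ₁² + κ₂²)²
  -- / N`.
  refine ofReal_one_sub_le_measure (M := 3 * g ^ 2 / N)
    (u := fun W => (1 + κ₂ ^ 2 / κ₁ ^ 2) * empError ξ₁ K₁ X W.1 ^ 2
      + (1 + κ₁ ^ 2 / κ₂ ^ 2) * empError ξ₂ K₂ X W.2 ^ 2)
    ((hi₁.const_mul _).add (hi₂.const_mul _)) (fun W => by positivity) (by positivity) hδ₀ ?_ ?_
  · rw [integral_add (hi₁.const_mul _) (hi₂.const_mul _), integral_const_mul, integral_const_mul,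
      integral_fun_fst (fun W => empError ξ₁ K₁ X W ^ 2),
      integral_fun_snd (fun W => empError ξ₂ K₂ X W ^ 2)]
    simp only [probReal_univ, one_smul]
    calc _ ≤ (1 + κ₂ ^ 2 / κ₁ ^ 2) * (3 * κ₁ ^ 4 / N) + (1 + κ₁ ^ 2 / κ₂ ^ 2) * (3 * κ₂ ^ 4 / N) := by
          gcongr
          · exact integral_empError_sq_le hξ₁ hK₁b hm hN X
          · exact integral_empError_sq_le hξ₂ hK₂b hm hN X
      _ = 3 * g ^ 2 / N := by
          rw [hg]
          field_simp
          ring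
  · intro W hW
    have hstab := abs_sinkhornDiv_sub_le hε
      ((hK₁.posSemidef_gram X).smul hm0) ((posSemidef_empCov ξ₁ X W.1).smul hm0)
      ((hK₂.posSemidef_gram X).smul hm0) ((posSemidef_empCov ξ₂ X W.2).smul hm0)
      (hsNorm_gram_le hK₁ hK₁b hm X) (hsNorm_gram_le hK₂ hK₂b hm X)
    refine hstab.trans (stability_bound_le hε hδ₀ hδ₁ (by positivity) ?_ ?_)
    · rw [div_le_one (by positivity)]
      exact Real.one_le_sqrt.2 (by exact_mod_cast hN)
    · refine (sq_add_le_weighted hκ₁2 hκ₂2 _ _).trans (hW.trans (le_of_eq ?_))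
      rw [div_pow, Real.sq_sqrt hN'.le]
      ring
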